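/- Consider a discrete memoryless channel with finite input alphabet $\mathcal X$, finite output alphabet $\mathcal Y$ and transition law $W(\cdot|\cdot)$. Let $0\in\mathcal X$ be the "off" symbol and $Q_0=W(\cdot|0)$. Assume that $Q_0(y)>0$ for every $y\in\mathcal Y$ and that distinct input symbols induce distinct output distributions. Let $\delta>0$. All logarithms are natural. A random code of blocklength $n$ for a finite message set $\mathcal M$ is a random pair of an encoder $\mathcal M\to\mathcal X^n$ and a decoder $\mathcal Y^n\to\mathcal M$, which is known to transmitter and receiver and independent of the message; the message is uniform on $\mathcal M$. Let $Q^n$ be the distribution induced on $\mathcal Y^n$ by the random code, the message and the channel. For $\epsilon>0$ let $K_n(\delta,\epsilon)$ be the maximum (possibly infinite) of $\log|\mathcal M|$ over all $\mathcal M$ for which there is a random code of blocklength $n$ with $D(Q^n\|Q_0^{\times n})\le\delta$ and average error probability at most $\epsilon$, and let $$L=\lim_{\epsilon\downarrow0}\ \liminf_{n\to\infty}\frac{K_n(\delta,\epsilon)}{\sqrt{n\delta}}\in[0,\infty].$$ For an input distribution $P_n$ on $\mathcal X$ let $Q_n=\sum_x P_n(x)W(\cdot|x)$ be the induced output distribution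 and $I(P_n,W)=\sum_x P_n(x)D(W(\cdot|x)\|Q_n)$ the mutual information. Then, for every $n\ge1$, the maximum of $I(P_n,W)$ over the input distributions $P_n$ with $D(Q_n\|Q_0)\le\delta/n$ is attained, the following limit exists in $[0,\infty]$, and $$L=\lim_{n\to\infty}\sqrt{\frac n\delta}\;\max_{P_n:\,D(Q_n\|Q_0)\le\delta/n} I(P_n,W).$$ Equivalently, $$L=\max_{\{P_n\}}\ \lim_{n\to\infty}\sqrt{\frac n\delta}\,I(P_n,W),$$ where the maximum, which is attained, is over the sequences $\{P_n\}$ of input distributions with $D(Q_n\|Q_0)\le\delta/n$ for all $n\ge1$ for which the limit exists in $[0,\infty]$. If the symbol $0$ is redundant, i.e. $Q_0\in\mathrm{conv}\{W(\cdot|x):x\ne0\}$, then $L=\infty$. -/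

import Mathlib

open Filter Topology

noncomputable section

/-- Relative entropy `D(q ‖ p)` (in nats) of two probability vectors on a finite alphabet.
It is `+∞` unless `q` is absolutely continuous with respect to `p`; a summand with `q y = 0`
is zero. -/
def relEntropy {Y : Type*} [Fintype Y] (q p : Y → ℝ) : EReal :=
  open Classical in
  if ∀ y, p y = 0 → q y = 0 then ((∑ y, q y * Real.log (q y / p y) : ℝ) : EReal) else ⊤

/-- A discrete memoryless channel with finite alphabets; `law x y` is `W(y|x)`. -/
structure DMC (X Y : Type*) [Fintype Y] where
  law : X → Y → ℝ
  law_mem : ∀ x, law x ∈ stdSimplex ℝ Y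

/-- A deterministic code of blocklength `n` for `m` messages: an encoder and a decoder. -/
abbrev Code (X Y : Type*) (n m : ℕ) : Type _ :=
  (Fin m → Fin n → X) × ((Fin n → Y) → Fin m)

namespace DMC

variable {X Y : Type*} [Fintype X] [Fintype Y]

/-- The output distribution that the input distribution `P` induces through the channel. -/
def output (W : DMC X Y) (P : X → ℝ) (y : Y) : ℝ := ∑ x, P x * W.law x y

/-- The mutual information `I(P, W)` (in nats); summands with `P x * W(y|x) = 0` are zero. -/
def mutualInfo (W : DMC X Y) (P : X → ℝ) : ℝ :=
  ∑ x, ∑ y, P x * W.law x y * Real.log (W.law x y / W.output P y)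

/-- The input symbol `x` is redundant: `W(·|x)` is a mixture of the other output distributions. -/
def Redundant {X Y : Type*} [Fintype Y] (W : DMC X Y) (x : X) : Prop :=
  W.law x ∈ convexHull ℝ (W.law '' {x' | x' ≠ x})

/-- The law of `n` independent uses of the channel. -/
def blockLaw {X Y : Type*} [Fintype Y] (W : DMC X Y) {n : ℕ}
    (x : Fin n → X) (y : Fin n → Y) : ℝ :=
  ∏ i, W.law (x i) (y i)

/-- The distribution on output blocks induced by the random code whose law on the finite set of
deterministic codes is `C`, together with an independent, uniformly distributed message. -/
def codeOutput [DecidableEq Y] (W : DMC X Y) {n m : ℕ} (C : Code X Y n m → ℝ)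
    (y : Fin n → Y) : ℝ :=
  ∑ c, C c * ((∑ j, W.blockLaw (c.1 j) y) / m)

/-- The average error probability of the random code `C`, averaged over the code, a uniformly
distributed message and the channel. -/
def errorProb [DecidableEq Y] (W : DMC X Y) {n m : ℕ} (C : Code X Y n m → ℝ) : ℝ :=
  ∑ c, C c * ((∑ j, ∑ y with c.2 y ≠ j, W.blockLaw (c.1 j) y) / m)

/-- There is a random code of blocklength `n` for `m` messages which satisfies
`D(Qⁿ ‖ Q₀ⁿ) ≤ δ`, where `Q₀ = W(·|x₀)`, and has average error probability at most `ε`. -/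
def Achievable [DecidableEq Y] (W : DMC X Y) (x₀ : X) (n : ℕ) (δ ε : ℝ) (m : ℕ) : Prop :=
  0 < m ∧ ∃ C ∈ stdSimplex ℝ (Code X Y n m),
    relEntropy (W.codeOutput C) (W.blockLaw fun _ => x₀) ≤ (δ : EReal) ∧ W.errorProb C ≤ ε

/-- `K_n(δ, ε)`: the largest `log |M|` among the achievable message sets `M`. -/
def maxLogSize [DecidableEq Y] (W : DMC X Y) (x₀ : X) (n : ℕ) (δ ε : ℝ) : EReal :=
  sSup {k | ∃ m, W.Achievable x₀ n δ ε m ∧ k = (Real.log m : EReal)}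

/-- The limit inferior in `n` of `K_n(δ, ε) / √(n δ)`. -/
def liminfRate [DecidableEq Y] (W : DMC X Y) (x₀ : X) (δ ε : ℝ) : EReal :=
  liminf (fun n : ℕ => W.maxLogSize x₀ n δ ε / (√(n * δ) : ℝ)) atTop

/-- The constant `L = lim_{ε ↓ 0} liminf_{n → ∞} K_n(δ, ε) / √(n δ)`, possibly infinite. -/
def scalingConstant [DecidableEq Y] (W : DMC X Y) (x₀ : X) (δ : ℝ) : EReal :=
  limUnder (𝓝[>] (0 : ℝ)) fun ε => W.liminfRate x₀ δ ε

theorem liminfRate_mono [DecidableEq Y] (W : DMC X Y) (x₀ : X) (δ : ℝ) :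
    Monotone fun ε => W.liminfRate x₀ δ ε := by
  intro ε ε' h
  refine liminf_le_liminf (Eventually.of_forall fun n => ?_)
  refine EReal.div_le_div_right_of_nonneg (by exact_mod_cast Real.sqrt_nonneg _) ?_
  refine sSup_le_sSup ?_
  rintro k ⟨m, ⟨hm, C, hC, hD, hE⟩, rfl⟩
  exact ⟨m, ⟨hm, C, hC, hD, hE.trans h⟩, rfl⟩

/-- The limit in the definition of `scalingConstant` always exists. -/
theorem tendsto_scalingConstant [DecidableEq Y] (W : DMC X Y) (x₀ : X) (δ : ℝ) :
    Tendsto (fun ε => W.liminfRate x₀ δ ε) (𝓝[>] (0 : ℝ)) (𝓝 (W.scalingConstant x₀ δ)) :=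
  tendsto_nhds_limUnder ⟨_, (W.liminfRate_mono x₀ δ).tendsto_nhdsGT 0⟩

/-- The input distributions `P` whose output distribution `Q` satisfies `D(Q ‖ Q₀) ≤ r`. -/
def admissible (W : DMC X Y) (x₀ : X) (r : ℝ) : Set (X → ℝ) :=
  {P | P ∈ stdSimplex ℝ X ∧ relEntropy (W.output P) (W.law x₀) ≤ (r : EReal)}

/-- The maximum of `I(P, W)` over the input distributions `P` with `D(Q ‖ Q₀) ≤ r`. -/
def maxInfo (W : DMC X Y) (x₀ : X) (r : ℝ) : ℝ :=
  sSup (W.mutualInfo '' W.admissible x₀ r)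

end DMC

end

open InformationTheory (klFun klFun_nonneg)

/-! ### Quadratic bounds on `klFun` -/

/-! Both `L` and the limit of the scaled maxima equal the supremum in `[0, ∞]` of one set of
numbers, `DMC.rateSet`.

The information splits as `I(P, W) = meanDiv P - D(Q ‖ Q₀)` (`DMC.mutualInfo_eq`). The first term is
linear in `P`. The second is at most `δ / n` under the constraint, so it vanishes after
multiplication by `√(n / δ)`. Near `Q₀` one has `D ≈ χ² / 2`, and sending `P` with probability `κ /
√n` and the off symbol otherwise scales `χ²` by `κ² / n` and `meanDiv` by `κ / √n`. The constraint
thus becomes `κ² χ² < 2δ`, up to factors tending to 1, and the normalized rate `κ meanDiv P / √δ`.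
Conversely every admissible `P` is nearly of this kind, with `κ ≈ √n` (`DMC.eventually_meanDiv_le`).

Achievability: an i.i.d. codebook, averaged over the code, has exactly a product output law, so the
divergence constraint is single-letter and independent of the rate. The decoder thresholds the
likelihood ratio against `Q₀`; its errors are controlled by a Chernoff bound and by the second
moment `(1 + χ²) ^ n`, which stays bounded because `χ²` is of order `1 / n`
(`DMC.exists_errorProb_iidCode_le`).

Converse: the letter-averaged input satisfies the single-letter constraint, and a change of measure
to `Q₀`, in place of Fano's inequality, gives `(1 - ε) log m ≤ n meanDiv + 1`
(`DMC.Achievable.exists_log_le`). If `0` is redundant, some `P` has `χ² = 0` and `meanDiv P > 0`, so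
`κ` is unrestricted. -/

theorem Real.log_le_half_sub_inv {u : ℝ} (hu : 1 ≤ u) : Real.log u ≤ (u - u⁻¹) / 2 := by
  rw [← Real.sinh_log (by linarith)]
  exact Real.self_le_sinh_iff.2 (Real.log_nonneg hu)

theorem Real.two_mul_sub_one_div_add_one_le_log {u : ℝ} (hu : 1 ≤ u) :
    2 * (u - 1) / (u + 1) ≤ Real.log u := by
  have h := Real.le_log_one_add_of_nonneg (x := u - 1) (by linarith)
  have e1 : u - 1 + 2 = u + 1 := by ring
  have e2 : 1 + (u - 1) = u := by ring
  rwa [e1, e2] at h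

/-- Quantifies `klFun t ≈ (t - 1) ^ 2 / 2` near 1. Only `b = max t 1` needs proof; each side of 1
uses one of the two logarithm bounds, both exact to second order at 1. The reverse bound below uses
`min t 1`. -/
theorem InformationTheory.sq_div_le_klFun {t b : ℝ} (ht : 0 ≤ t) (htb : t ≤ b) (hb : 1 ≤ b) :
    (t - 1) ^ 2 / (2 * b) ≤ klFun t := by
  rw [div_le_iff₀ (by linarith)]
  refine le_trans ?_ (mul_le_mul_of_nonneg_left
    (mul_le_mul_of_nonneg_left (max_le htb hb) zero_le_two) (klFun_nonneg ht))
  rcases le_total 1 t with h | h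
  · rw [max_eq_left h, InformationTheory.klFun]
    have h1 := Real.two_mul_sub_one_div_add_one_le_log h
    have h2 : (t - 1) ^ 2 / (t + 1) ≤ t * Real.log t + 1 - t := by
      have := mul_le_mul_of_nonneg_left h1 ht
      have e : (t - 1) ^ 2 / (t + 1) = t * (2 * (t - 1) / (t + 1)) + 1 - t := by
        field_simp; ring
      linarith
    have h3 : (t - 1) ^ 2 ≤ (t - 1) ^ 2 / (t + 1) * (2 * t) := by
      rw [div_mul_eq_mul_div, le_div_iff₀ (by linarith)]
      exact mul_le_mul_of_nonneg_left (by linarith) (sq_nonneg _)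
    exact h3.trans (mul_le_mul_of_nonneg_right h2 (by linarith))
  · rw [max_eq_right h, InformationTheory.klFun]
    rcases ht.eq_or_lt with rfl | ht'
    · norm_num
    · have h1 := Real.log_le_half_sub_inv ((one_le_inv₀ ht').2 h)
      rw [Real.log_inv, inv_inv] at h1
      have := mul_le_mul_of_nonneg_left h1 ht
      have e : t * ((t⁻¹ - t) / 2) = (1 - t ^ 2) / 2 := by field_simp
      nlinarith

theorem InformationTheory.klFun_le_sq_div {t b : ℝ} (hb : 0 < b) (hb1 : b ≤ 1) (hbt : b ≤ t) :
    klFun t ≤ (t - 1) ^ 2 / (2 * b) := by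
  have ht : 0 < t := hb.trans_le hbt
  rw [le_div_iff₀ (by linarith)]
  refine (mul_le_mul_of_nonneg_left
    (mul_le_mul_of_nonneg_left (le_min hbt hb1) zero_le_two) (klFun_nonneg ht.le)).trans ?_
  rcases le_total 1 t with h | h
  · rw [min_eq_right h, InformationTheory.klFun]
    have := mul_le_mul_of_nonneg_left (Real.log_le_half_sub_inv h) ht.le
    have e : t * ((t - t⁻¹) / 2) = (t ^ 2 - 1) / 2 := by field_simp
    nlinarith
  · rw [min_eq_left h, InformationTheory.klFun]
    have h1 := Real.two_mul_sub_one_div_add_one_le_log ((one_le_inv₀ ht).2 h)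
    rw [Real.log_inv] at h1
    have e : 2 * (t⁻¹ - 1) / (t⁻¹ + 1) = 2 * (1 - t) / (1 + t) := by
      field_simp
    rw [e, div_le_iff₀ (by linarith)] at h1
    have h2 : (t * Real.log t + 1 - t) * (2 * t) * (1 + t) ≤ (t - 1) ^ 2 * (1 + t) := by
      have h3 := mul_le_mul_of_nonneg_left h1 (mul_nonneg ht.le ht.le)
      have h4 : 0 ≤ (1 - t) * (1 - t) ^ 2 := mul_nonneg (by linarith) (sq_nonneg _)
      nlinarith
    exact le_of_mul_le_mul_right h2 (by linarith)

/-! ### Relative entropy on a finite alphabet -/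

section Divergence

variable {Y : Type*} [Fintype Y]

/-- The relative entropy `D(q ‖ p)` as a real number, for a vector `p` without zeros. -/
noncomputable def realKL (q p : Y → ℝ) : ℝ := ∑ y, q y * Real.log (q y / p y)

/-- The chi-square divergence of `q` from `p`. -/
noncomputable def chiSq (q p : Y → ℝ) : ℝ := ∑ y, (q y - p y) ^ 2 / p y

theorem relEntropy_eq_realKL {q p : Y → ℝ} (hp : ∀ y, 0 < p y) :
    relEntropy q p = (realKL q p : EReal) := by
  rw [relEntropy, if_pos fun y h => absurd h (hp y).ne']
  rfl

theorem realKL_eq_sum_klFun {q p : Y → ℝ} (hp : ∀ y, 0 < p y) (h : ∑ y, q y = ∑ y, p y) :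
    realKL q p = ∑ y, p y * klFun (q y / p y) := by
  have e : ∀ y, p y * klFun (q y / p y) = q y * Real.log (q y / p y) + (p y - q y) := by
    intro y
    have := (hp y).ne'
    rw [InformationTheory.klFun]
    field_simp
    ring
  simp_rw [e, Finset.sum_add_distrib, Finset.sum_sub_distrib, h, sub_self, add_zero]
  rfl

theorem realKL_nonneg {q p : Y → ℝ} (hp : ∀ y, 0 < p y) (hq : ∀ y, 0 ≤ q y)
    (h : ∑ y, q y = ∑ y, p y) : 0 ≤ realKL q p := by
  rw [realKL_eq_sum_klFun hp h]
  exact Finset.sum_nonneg fun y _ =>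
    mul_nonneg (hp y).le (klFun_nonneg (div_nonneg (hq y) (hp y).le))

theorem chiSq_nonneg {q p : Y → ℝ} (hp : ∀ y, 0 < p y) : 0 ≤ chiSq q p :=
  Finset.sum_nonneg fun y _ => div_nonneg (sq_nonneg _) (hp y).le

theorem chiSq_term {a b : ℝ} (hb : 0 < b) : (a - b) ^ 2 / b = b * (a / b - 1) ^ 2 := by
  field_simp

theorem chiSq_le_mul_realKL {q p : Y → ℝ} {b : ℝ} (hp : ∀ y, 0 < p y) (hq : ∀ y, 0 ≤ q y)
    (h : ∑ y, q y = ∑ y, p y) (hb : 1 ≤ b) (hqb : ∀ y, q y / p y ≤ b) :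
    chiSq q p ≤ 2 * b * realKL q p := by
  rw [realKL_eq_sum_klFun hp h, Finset.mul_sum]
  refine Finset.sum_le_sum fun y _ => ?_
  have h1 := InformationTheory.sq_div_le_klFun (div_nonneg (hq y) (hp y).le) (hqb y) hb
  rw [div_le_iff₀ (by linarith)] at h1
  rw [chiSq_term (hp y)]
  nlinarith [mul_le_mul_of_nonneg_left h1 (hp y).le]

theorem realKL_le_chiSq_div {q p : Y → ℝ} {b : ℝ} (hp : ∀ y, 0 < p y)
    (h : ∑ y, q y = ∑ y, p y) (hb : 0 < b) (hb1 : b ≤ 1) (hqb : ∀ y, b ≤ q y / p y) :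
    realKL q p ≤ chiSq q p / (2 * b) := by
  rw [realKL_eq_sum_klFun hp h, chiSq, Finset.sum_div]
  refine Finset.sum_le_sum fun y _ => ?_
  rw [chiSq_term (hp y), mul_div_assoc]
  exact mul_le_mul_of_nonneg_left
    (InformationTheory.klFun_le_sq_div hb hb1 (hqb y)) (hp y).le

/-- Near `p`, the chi-square divergence is at most about twice the relative entropy. -/
theorem exists_chiSq_le_of_realKL_le {p : Y → ℝ} (hp : ∀ y, 0 < p y) (hp1 : ∑ y, p y = 1)
    {η : ℝ} (hη : 1 < η) :
    ∃ r₀ > 0, ∀ q ∈ stdSimplex ℝ Y, realKL q p ≤ r₀ → chiSq q p ≤ 2 * η * realKL q p := by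
  obtain ⟨c, hc, hcp⟩ : ∃ c > 0, ∀ y, c ≤ p y := by
    rcases isEmpty_or_nonempty Y with hY | hY
    · exact ⟨1, one_pos, fun y => hY.elim y⟩
    · obtain ⟨y, hy⟩ := Finite.exists_min p
      exact ⟨p y, hp y, hy⟩
  -- Bootstrap: the crude ratio bound `q / p ≤ max 1 c⁻¹` makes `chiSq` at most `c * (η - 1) ^ 2`
  -- for this radius. Every ratio is then at most `η`, and the same inequality applies again with
  -- the sharp constant.
  refine ⟨c * (η - 1) ^ 2 / (2 * max 1 c⁻¹), by
    have := sub_pos.2 hη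
    positivity, fun q hq hr => ?_⟩
  have hsum : ∑ y, q y = ∑ y, p y := by rw [hq.2, hp1]
  have hb : ∀ y, q y / p y ≤ max 1 c⁻¹ := fun y => by
    refine le_max_of_le_right ?_
    rw [div_eq_mul_inv]
    have hq1 : q y ≤ 1 := hq.2 ▸ Finset.single_le_sum (fun i _ => hq.1 i) (Finset.mem_univ y)
    calc q y * (p y)⁻¹ ≤ 1 * c⁻¹ :=
        mul_le_mul hq1 (inv_anti₀ hc (hcp y)) (inv_nonneg.2 (hp y).le) zero_le_one
      _ = c⁻¹ := one_mul _
  have h1 := chiSq_le_mul_realKL hp hq.1 hsum (le_max_left 1 c⁻¹) hb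
  refine chiSq_le_mul_realKL hp hq.1 hsum hη.le fun y => ?_
  have h2 : p y * (q y / p y - 1) ^ 2 ≤ chiSq q p := by
    rw [← chiSq_term (hp y)]
    exact Finset.single_le_sum (f := fun y => (q y - p y) ^ 2 / p y)
      (fun i _ => div_nonneg (sq_nonneg _) (hp i).le) (Finset.mem_univ y)
  have hm : 0 < max 1 c⁻¹ := lt_max_of_lt_left one_pos
  rw [le_div_iff₀ (by positivity)] at hr
  have h3 : c * (q y / p y - 1) ^ 2 ≤ c * (η - 1) ^ 2 := by
    have := mul_le_mul_of_nonneg_right (hcp y) (sq_nonneg (q y / p y - 1))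
    linarith
  have h4 := abs_le_of_sq_le_sq (le_of_mul_le_mul_left h3 hc) (by linarith)
  linarith [(abs_le.1 h4).2]

/-- Gibbs' inequality. -/
theorem sum_mul_log_div_nonneg {q r : Y → ℝ} (hq : q ∈ stdSimplex ℝ Y) (hr : r ∈ stdSimplex ℝ Y)
    (h : ∀ y, r y = 0 → q y = 0) : 0 ≤ ∑ y, q y * Real.log (q y / r y) := by
  have key : ∀ y, q y - r y ≤ q y * Real.log (q y / r y) := by
    intro y
    rcases (hq.1 y).eq_or_lt with h0 | h0
    · rw [← h0]; simpa using hr.1 y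
    · have hr0 : 0 < r y := (hr.1 y).lt_of_ne fun e => h0.ne' (h y e.symm)
      have h1 := Real.one_sub_inv_le_log_of_pos (div_pos h0 hr0)
      have := mul_le_mul_of_nonneg_left h1 h0.le
      have e : q y * (1 - (q y / r y)⁻¹) = q y - r y := by field_simp
      linarith
  have := Finset.sum_le_sum fun y (_ : y ∈ Finset.univ) => key y
  rwa [Finset.sum_sub_distrib, hq.2, hr.2, sub_self] at this

/-- A pointwise form of the variational formula for relative entropy. -/
theorem mul_log_div_ge {a b : ℝ} (ha : 0 ≤ a) (hb : 0 < b) (t : ℝ) :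
    a * t + a - b * Real.exp t ≤ a * Real.log (a / b) := by
  rcases ha.eq_or_lt with rfl | ha
  · simp; positivity
  · have h1 := Real.add_one_le_exp (t - Real.log (a / b))
    rw [Real.exp_sub, Real.exp_log (div_pos ha hb)] at h1
    have h2 := mul_le_mul_of_nonneg_left h1 ha.le
    have e : a * (Real.exp t / (a / b)) = b * Real.exp t := by field_simp
    linarith

end Divergence

/-! ### Sums of products over function types -/

section Products

variable {ι κ : Type*} [Fintype ι] [Fintype κ]

theorem Fintype.sum_prod_apply [DecidableEq ι] (f : ι → κ → ℝ) :
    ∑ e : ι → κ, ∏ i, f i (e i) = ∏ i, ∑ x, f i x := by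
  rw [Finset.prod_univ_sum, Fintype.piFinset_univ]

theorem prod_mem_stdSimplex [DecidableEq ι] {p : ι → κ → ℝ} (hp : ∀ i, p i ∈ stdSimplex ℝ κ) :
    (fun e : ι → κ => ∏ i, p i (e i)) ∈ stdSimplex ℝ (ι → κ) :=
  ⟨fun e => Finset.prod_nonneg fun i _ => (hp i).1 _, by
    rw [Fintype.sum_prod_apply]
    exact Finset.prod_eq_one fun i _ => (hp i).2⟩

theorem sum_prod_mul_apply_of_forall [DecidableEq ι] {p : ι → κ → ℝ} (hp : ∀ i, ∑ x, p i x = 1)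
    (j : ι) (u : κ → ℝ) :
    ∑ e : ι → κ, (∏ i, p i (e i)) * u (e j) = ∑ x, p j x * u x := by
  have : ∀ e : ι → κ, (∏ i, p i (e i)) * u (e j) =
      ∏ i, p i (e i) * (if i = j then u (e i) else 1) := fun e => by
    rw [Finset.prod_mul_distrib, Finset.prod_ite_eq' Finset.univ j, if_pos (Finset.mem_univ j)]
  simp_rw [this]
  rw [Fintype.sum_prod_apply (fun i x => p i x * (if i = j then u x else 1)),
    Finset.prod_eq_single j]
  · simp
  · intro i _ hi
    simp [hi, hp]
  · simp

theorem sum_prod_mul_apply [DecidableEq ι] {p : κ → ℝ} (hp : ∑ x, p x = 1) (j : ι) (u : κ → ℝ) :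
    ∑ e : ι → κ, (∏ i, p (e i)) * u (e j) = ∑ x, p x * u x :=
  sum_prod_mul_apply_of_forall (p := fun _ => p) (fun _ => hp) j u

theorem sum_prod_mul_apply_mul_apply [DecidableEq ι] {p : κ → ℝ} (hp : ∑ x, p x = 1) {j k : ι}
    (hjk : j ≠ k) (u v : κ → ℝ) :
    ∑ e : ι → κ, (∏ i, p (e i)) * (u (e j) * v (e k)) =
      (∑ x, p x * u x) * ∑ x, p x * v x := by
  have : ∀ e : ι → κ, (∏ i, p (e i)) * (u (e j) * v (e k)) =
      ∏ i, p (e i) * ((if i = j then u (e i) else 1) * (if i = k then v (e i) else 1)) :=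
    fun e => by
      rw [Finset.prod_mul_distrib, Finset.prod_mul_distrib,
        Finset.prod_ite_eq' Finset.univ j, if_pos (Finset.mem_univ j),
        Finset.prod_ite_eq' Finset.univ k, if_pos (Finset.mem_univ k)]
  simp_rw [this]
  rw [Fintype.sum_prod_apply
      (fun i x => p x * ((if i = j then u x else 1) * (if i = k then v x else 1))),
    Finset.prod_eq_mul j k hjk]
  · simp [hjk, hjk.symm]
  · intro i _ hi
    simp [hi.1, hi.2, hp]
  · simp
  · simp

end Products

namespace DMC

variable {X Y : Type*} [Fintype X] [Fintype Y]

/-! ### Output distributions, and mutual information as a difference of divergences -/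

open Classical in
/-- The input distribution which always sends `x₀`. -/
noncomputable def pointMass (x₀ : X) (x : X) : ℝ := if x₀ = x then 1 else 0

theorem pointMass_mem (x₀ : X) : pointMass x₀ ∈ stdSimplex ℝ X := by
  classical
  convert ite_eq_mem_stdSimplex ℝ x₀ using 1
  exact funext fun x => by simp only [pointMass]

theorem sum_pointMass_mul (x₀ : X) (f : X → ℝ) : ∑ x, pointMass x₀ x * f x = f x₀ := by
  classical
  simp [pointMass]

/-- The input distribution which sends `x₀` with probability `1 - a` and is `P` otherwise. -/
noncomputable def mixture (x₀ : X) (P : X → ℝ) (a : ℝ) (x : X) : ℝ :=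
  (1 - a) * pointMass x₀ x + a * P x

theorem sum_mixture_mul (x₀ : X) (P : X → ℝ) (a : ℝ) (f : X → ℝ) :
    ∑ x, mixture x₀ P a x * f x = (1 - a) * f x₀ + a * ∑ x, P x * f x := by
  simp_rw [mixture, add_mul, mul_assoc, Finset.sum_add_distrib, ← Finset.mul_sum,
    sum_pointMass_mul]

theorem mixture_mem (x₀ : X) {P : X → ℝ} (hP : P ∈ stdSimplex ℝ X) {a : ℝ} (ha : 0 ≤ a)
    (ha1 : a ≤ 1) : mixture x₀ P a ∈ stdSimplex ℝ X :=
  convex_stdSimplex ℝ X (pointMass_mem x₀) hP (sub_nonneg.2 ha1) ha (by ring)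

/-- The mean divergence of the conditional output distributions from that of `x₀`. -/
noncomputable def meanDiv (W : DMC X Y) (x₀ : X) (P : X → ℝ) : ℝ :=
  ∑ x, P x * realKL (W.law x) (W.law x₀)

variable (W : DMC X Y) (x₀ : X)

theorem sum_law {X Y : Type*} [Fintype Y] (W : DMC X Y) (x : X) :
    ∑ y, W.law x y = 1 :=
  (W.law_mem x).2

theorem law_nonneg {X Y : Type*} [Fintype Y] (W : DMC X Y) (x : X) (y : Y) :
    0 ≤ W.law x y :=
  (W.law_mem x).1 y

theorem output_mem {P : X → ℝ} (hP : P ∈ stdSimplex ℝ X) : W.output P ∈ stdSimplex ℝ Y := by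
  refine ⟨fun y => Finset.sum_nonneg fun x _ => mul_nonneg (hP.1 x) (W.law_nonneg x y), ?_⟩
  simp only [output]
  rw [Finset.sum_comm]
  simp_rw [← Finset.mul_sum, W.sum_law, mul_one, hP.2]

theorem sum_output_eq {P : X → ℝ} (hP : P ∈ stdSimplex ℝ X) :
    ∑ y, W.output P y = ∑ y, W.law x₀ y := by
  rw [(W.output_mem hP).2, W.sum_law]

theorem output_pointMass : W.output (pointMass x₀) = W.law x₀ :=
  funext fun y => sum_pointMass_mul x₀ fun x => W.law x y

theorem output_mixture (P : X → ℝ) (a : ℝ) (y : Y) :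
    W.output (mixture x₀ P a) y = (1 - a) * W.law x₀ y + a * W.output P y :=
  sum_mixture_mul x₀ P a fun x => W.law x y

theorem realKL_self {p : Y → ℝ} : realKL p p = 0 :=
  Finset.sum_eq_zero fun y _ => by
    rcases eq_or_ne (p y) 0 with h | h <;> simp [h]

theorem meanDiv_mixture (P : X → ℝ) (a : ℝ) :
    W.meanDiv x₀ (mixture x₀ P a) = a * W.meanDiv x₀ P := by
  rw [meanDiv, sum_mixture_mul, realKL_self, mul_zero, zero_add, meanDiv]

theorem chiSq_output_mixture (P : X → ℝ) (a : ℝ) :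
    chiSq (W.output (mixture x₀ P a)) (W.law x₀) = a ^ 2 * chiSq (W.output P) (W.law x₀) := by
  rw [chiSq, chiSq, Finset.mul_sum]
  refine Finset.sum_congr rfl fun y _ => ?_
  rw [output_mixture]
  ring

variable {x₀}

/-- The off symbol alone keeps all ratios to `Q₀` above `1 - a`, which bounds the error of the
quadratic approximation. -/
theorem realKL_output_mixture_le (h0 : ∀ y, 0 < W.law x₀ y) {P : X → ℝ}
    (hP : P ∈ stdSimplex ℝ X) {a : ℝ} (ha : 0 ≤ a) (ha1 : a < 1) :
    realKL (W.output (mixture x₀ P a)) (W.law x₀) ≤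
      a ^ 2 * chiSq (W.output P) (W.law x₀) / (2 * (1 - a)) := by
  rw [← chiSq_output_mixture]
  refine realKL_le_chiSq_div h0 (W.sum_output_eq x₀ (mixture_mem x₀ hP ha ha1.le))
    (sub_pos.2 ha1) (by linarith) fun y => ?_
  rw [le_div_iff₀ (h0 y), output_mixture]
  linarith [mul_nonneg ha ((W.output_mem hP).1 y)]

theorem mem_admissible_iff (h0 : ∀ y, 0 < W.law x₀ y) {r : ℝ} {P : X → ℝ} :
    P ∈ W.admissible x₀ r ↔
      P ∈ stdSimplex ℝ X ∧ realKL (W.output P) (W.law x₀) ≤ r := by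
  rw [admissible, Set.mem_ofPred_eq, relEntropy_eq_realKL h0, EReal.coe_le_coe_iff]

/-- Comes from `log (W / Q) = log (W / Q₀) - log (Q / Q₀)` wherever the weight `P x * W(y|x)` is
nonzero. It also yields the continuity of the mutual information on the simplex. -/
theorem mutualInfo_eq (h0 : ∀ y, 0 < W.law x₀ y) {P : X → ℝ} (hP : ∀ x, 0 ≤ P x) :
    W.mutualInfo P = W.meanDiv x₀ P - realKL (W.output P) (W.law x₀) := by
  have e : realKL (W.output P) (W.law x₀) =
      ∑ x, ∑ y, P x * W.law x y * Real.log (W.output P y / W.law x₀ y) := by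
    rw [Finset.sum_comm]
    refine Finset.sum_congr rfl fun _ _ => ?_
    rw [← Finset.sum_mul, output]
  rw [e, meanDiv, ← Finset.sum_sub_distrib, mutualInfo]
  refine Finset.sum_congr rfl fun x _ => ?_
  rw [realKL, Finset.mul_sum, ← Finset.sum_sub_distrib]
  refine Finset.sum_congr rfl fun y _ => ?_
  rcases eq_or_ne (P x * W.law x y) 0 with h | h
  · rw [← mul_assoc, h]; simp
  · have hw : W.law x y ≠ 0 := right_ne_zero_of_mul h
    have hq : 0 < W.output P y :=
      (lt_of_le_of_ne (mul_nonneg (hP x) (W.law_nonneg x y)) h.symm).trans_le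
        (Finset.single_le_sum (f := fun x => P x * W.law x y)
          (fun i _ => mul_nonneg (hP i) (W.law_nonneg i y)) (Finset.mem_univ x))
    rw [Real.log_div hw hq.ne', Real.log_div hw (h0 y).ne', Real.log_div hq.ne' (h0 y).ne']
    ring

theorem continuous_output : Continuous W.output :=
  continuous_pi fun _ => continuous_finsetSum _ fun x _ => (continuous_apply x).mul_const _

theorem continuous_realKL {p : Y → ℝ} (hp : ∀ y, 0 < p y) : Continuous fun q => realKL q p := by
  refine continuous_finsetSum _ fun y _ => ?_
  have e : (fun q : Y → ℝ => q y * Real.log (q y / p y)) =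
      fun q => p y * ((q y / p y) * Real.log (q y / p y)) := by
    funext q
    have := (hp y).ne'
    field_simp
  have h : Continuous fun q : Y → ℝ => q y / p y := by fun_prop
  rw [e]
  exact continuous_const.mul (Real.continuous_mul_log.comp h)

theorem continuous_meanDiv : Continuous (W.meanDiv x₀) :=
  continuous_finsetSum _ fun x _ => (continuous_apply x).mul_const _

theorem isGreatest_maxInfo (h0 : ∀ y, 0 < W.law x₀ y) {r : ℝ} (hr : 0 ≤ r) :
    IsGreatest (W.mutualInfo '' W.admissible x₀ r) (W.maxInfo x₀ r) := by
  have hcont := (continuous_realKL h0).comp W.continuous_output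
  have hadm : W.admissible x₀ r =
      stdSimplex ℝ X ∩ {P | realKL (W.output P) (W.law x₀) ≤ r} :=
    Set.ext fun P => W.mem_admissible_iff h0
  refine IsCompact.isGreatest_sSup (IsCompact.image_of_continuousOn ?_ ?_) ?_
  · rw [hadm]
    exact (isCompact_stdSimplex ℝ X).inter_right (isClosed_le hcont continuous_const)
  · refine ((W.continuous_meanDiv (x₀ := x₀)).sub hcont).continuousOn.congr fun P hP => ?_
    exact W.mutualInfo_eq h0 hP.1.1
  · exact ⟨_, pointMass x₀, (W.mem_admissible_iff h0).2
      ⟨pointMass_mem x₀, by rwa [output_pointMass, realKL_self]⟩, rfl⟩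

/-! ### Block laws -/

variable (x₀)

theorem sum_blockLaw {X Y : Type*} [Fintype Y] [DecidableEq Y] (W : DMC X Y) {n : ℕ}
    (x : Fin n → X) : ∑ y, W.blockLaw x y = 1 := by
  simp only [blockLaw]
  rw [Fintype.sum_prod_apply fun i y => W.law (x i) y]
  exact Finset.prod_eq_one fun i _ => W.sum_law _

theorem blockLaw_nonneg {X Y : Type*} [Fintype Y] (W : DMC X Y) {n : ℕ}
    (x : Fin n → X) (y : Fin n → Y) : 0 ≤ W.blockLaw x y :=
  Finset.prod_nonneg fun _ _ => W.law_nonneg _ _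

theorem blockLaw_pos {X Y : Type*} [Fintype Y] (W : DMC X Y) (x₀ : X)
    (h0 : ∀ y, 0 < W.law x₀ y) {n : ℕ} (y : Fin n → Y) :
    0 < W.blockLaw (fun _ => x₀) y :=
  Finset.prod_pos fun _ _ => h0 _

theorem sum_prod_mul_blockLaw {n : ℕ} (P : X → ℝ) (y : Fin n → Y) :
    ∑ x : Fin n → X, (∏ i, P (x i)) * W.blockLaw x y = ∏ i, W.output P (y i) := by
  simp_rw [blockLaw, ← Finset.prod_mul_distrib]
  exact Fintype.sum_prod_apply fun i x => P x * W.law x (y i)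

/-! ### The `i.i.d.` random code -/

open Classical in
/-- The random code whose codewords are independent with independent letters drawn from `P`, and
whose decoder is the function `g` of the codebook. -/
noncomputable def iidCode {n m : ℕ} (P : X → ℝ)
    (g : (Fin m → Fin n → X) → (Fin n → Y) → Fin m) (c : Code X Y n m) : ℝ :=
  if c.2 = g c.1 then ∏ j, ∏ i, P (c.1 j i) else 0

theorem sum_iidCode_mul [DecidableEq Y] {n m : ℕ} (P : X → ℝ)
    (g : (Fin m → Fin n → X) → (Fin n → Y) → Fin m) (F : Code X Y n m → ℝ) :
    ∑ c, iidCode P g c * F c =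
      ∑ e : Fin m → Fin n → X, (∏ j, ∏ i, P (e j i)) * F (e, g e) := by
  classical
  rw [Fintype.sum_prod_type]
  refine Finset.sum_congr rfl fun e _ => ?_
  rw [Finset.sum_eq_single (g e)]
  · simp [iidCode]
  · intro d _ hd
    simp [iidCode, hd]
  · simp

theorem sum_prod_iid {n : ℕ} {P : X → ℝ} (hP : P ∈ stdSimplex ℝ X) :
    ∑ x : Fin n → X, ∏ i, P (x i) = 1 :=
  (prod_mem_stdSimplex (ι := Fin n) fun _ => hP).2

theorem iidCode_mem [DecidableEq Y] {n m : ℕ} {P : X → ℝ} (hP : P ∈ stdSimplex ℝ X)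
    (g : (Fin m → Fin n → X) → (Fin n → Y) → Fin m) :
    iidCode P g ∈ stdSimplex ℝ (Code X Y n m) := by
  constructor
  · intro c
    rw [iidCode]
    split_ifs
    · exact Finset.prod_nonneg fun j _ => Finset.prod_nonneg fun i _ => hP.1 _
    · exact le_rfl
  · have := sum_iidCode_mul P g fun _ => 1
    simp only [mul_one] at this
    rw [this]
    exact (prod_mem_stdSimplex (ι := Fin m)
      fun _ => prod_mem_stdSimplex (ι := Fin n) fun _ => hP).2

/-- Each codeword, averaged over the codebook, has i.i.d. letters; correlations between codewords do
not enter, so no lower bound on `m` is needed. -/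
theorem codeOutput_iidCode [DecidableEq Y] {n m : ℕ} (hm : 0 < m) {P : X → ℝ}
    (hP : P ∈ stdSimplex ℝ X) (g : (Fin m → Fin n → X) → (Fin n → Y) → Fin m) (y : Fin n → Y) :
    W.codeOutput (iidCode P g) y = ∏ i, W.output P (y i) := by
  have hm' : (m : ℝ) ≠ 0 := by positivity
  rw [codeOutput, sum_iidCode_mul]
  simp only
  simp_rw [← mul_div_assoc, ← Finset.sum_div, Finset.mul_sum]
  rw [Finset.sum_comm, div_eq_iff hm']
  simp_rw [sum_prod_mul_apply (p := fun x : Fin n → X => ∏ i, P (x i)) (sum_prod_iid hP) _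
    (fun x => W.blockLaw x y), sum_prod_mul_blockLaw]
  simp [mul_comm]

/-- The chain rule for relative entropies of product distributions. -/
theorem realKL_prod [DecidableEq Y] {n : ℕ} {q : Fin n → Y → ℝ} {p : Y → ℝ}
    (hq : ∀ i, ∑ y, q i y = 1) (hp : ∀ y, 0 < p y) :
    realKL (fun y : Fin n → Y => ∏ i, q i (y i)) (fun y => ∏ i, p (y i)) =
      ∑ i, realKL (q i) p := by
  have e : ∀ y : Fin n → Y, (∏ i, q i (y i)) * Real.log ((∏ i, q i (y i)) / ∏ i, p (y i)) =
      ∑ j, (∏ i, q i (y i)) * Real.log (q j (y j) / p (y j)) := by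
    intro y
    by_cases h : ∏ i, q i (y i) = 0
    · simp [h]
    · rw [← Finset.prod_div_distrib, Real.log_prod, Finset.mul_sum]
      intro i _
      exact div_ne_zero (Finset.prod_ne_zero_iff.1 h i (Finset.mem_univ i)) (hp _).ne'
  rw [realKL]
  simp_rw [e]
  rw [Finset.sum_comm]
  refine Finset.sum_congr rfl fun j _ => ?_
  exact sum_prod_mul_apply_of_forall hq j fun z => Real.log (q j z / p z)

theorem relEntropy_codeOutput_iidCode [DecidableEq Y] (h0 : ∀ y, 0 < W.law x₀ y) {n m : ℕ}
    (hm : 0 < m) {P : X → ℝ} (hP : P ∈ stdSimplex ℝ X)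
    (g : (Fin m → Fin n → X) → (Fin n → Y) → Fin m) :
    relEntropy (W.codeOutput (iidCode P g)) (W.blockLaw fun _ : Fin n => x₀) =
      ((n * realKL (W.output P) (W.law x₀) : ℝ) : EReal) := by
  have h := realKL_prod (n := n) (fun _ => (W.output_mem hP).2) h0
  rw [Finset.sum_const, Finset.card_univ, Fintype.card_fin, nsmul_eq_mul] at h
  rw [relEntropy_eq_realKL (W.blockLaw_pos x₀ h0), funext (W.codeOutput_iidCode hm hP g), ← h]
  rfl

end DMC

namespace DMC

variable {X Y : Type*} [Fintype X] [Fintype Y] (W : DMC X Y) (x₀ : X)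

/-! ### Random coding bound -/

/-- The moment generating function at `-s` of the log-likelihood ratio with respect to `x₀`. -/
noncomputable def negMGF (P : X → ℝ) (s : ℝ) : ℝ :=
  ∑ x, P x * ∑ y, W.law x y * Real.exp (-(s * Real.log (W.law x y / W.law x₀ y)))

open Classical in
/-- The decoder which returns the only message satisfying `good`, if there is just one. -/
noncomputable def uniqueDecoder {ι κ : Type*} [Nonempty ι] (good : ι → κ → Prop) (y : κ) : ι :=
  if h : ∃ j, good j y ∧ ∀ k, k ≠ j → ¬ good k y then h.choose else Classical.arbitrary ι

theorem exists_good_of_uniqueDecoder_ne {ι κ : Type*} [Nonempty ι] {good : ι → κ → Prop}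
    {y : κ} {j : ι} (hj : good j y) (h : uniqueDecoder good y ≠ j) : ∃ k, k ≠ j ∧ good k y := by
  by_contra! hk
  have hex : ∃ j, good j y ∧ ∀ k, k ≠ j → ¬ good k y := ⟨j, hj, hk⟩
  rw [uniqueDecoder, dif_pos hex] at h
  exact h (by_contra fun hne => hex.choose_spec.2 j (Ne.symm hne) hj)

variable {x₀}

/-- Chernoff's bound for the likelihood ratio of a codeword not exceeding the threshold. -/
theorem blockLaw_le_chernoff {X Y : Type*} [Fintype Y] (W : DMC X Y) {x₀ : X}
    (h0 : ∀ y, 0 < W.law x₀ y) {n : ℕ} {s g : ℝ} (hs : 0 ≤ s)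
    {x : Fin n → X} {y : Fin n → Y}
    (h : W.blockLaw x y ≤ Real.exp g * W.blockLaw (fun _ => x₀) y) :
    W.blockLaw x y ≤ Real.exp (s * g) * ∏ i, W.law (x i) (y i) *
      Real.exp (-(s * Real.log (W.law (x i) (y i) / W.law x₀ (y i)))) := by
  rw [Finset.prod_mul_distrib, ← Real.exp_sum, Finset.sum_neg_distrib, ← Finset.mul_sum]
  change _ ≤ _ * (W.blockLaw x y * _)
  rcases (W.blockLaw_nonneg x y).eq_or_lt with hz | hz
  · rw [← hz]; simp
  have hlog : ∑ i, Real.log (W.law (x i) (y i) / W.law x₀ (y i)) ≤ g := by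
    rw [← Real.log_prod, Finset.prod_div_distrib]
    · change Real.log (W.blockLaw x y / W.blockLaw (fun _ => x₀) y) ≤ g
      rwa [Real.log_le_iff_le_exp (div_pos hz (W.blockLaw_pos x₀ h0 y)),
        div_le_iff₀ (W.blockLaw_pos x₀ h0 y)]
    · intro i _
      exact div_ne_zero (Finset.prod_ne_zero_iff.1 hz.ne' i (Finset.mem_univ i)) (h0 _).ne'
  rw [mul_left_comm, ← Real.exp_add]
  refine le_mul_of_one_le_right hz.le (Real.one_le_exp ?_)
  nlinarith [mul_le_mul_of_nonneg_left hlog hs]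

theorem sum_prod_mul_chernoff [DecidableEq Y] {n : ℕ} (P : X → ℝ) (s : ℝ) :
    ∑ x : Fin n → X, (∏ i, P (x i)) * ∑ y : Fin n → Y, ∏ i, W.law (x i) (y i) *
      Real.exp (-(s * Real.log (W.law (x i) (y i) / W.law x₀ (y i)))) =
      W.negMGF x₀ P s ^ n := by
  have e : ∀ x : Fin n → X, (∏ i, P (x i)) * ∑ y : Fin n → Y, ∏ i, W.law (x i) (y i) *
      Real.exp (-(s * Real.log (W.law (x i) (y i) / W.law x₀ (y i)))) =
      ∏ i, P (x i) * ∑ y, W.law (x i) y *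
        Real.exp (-(s * Real.log (W.law (x i) y / W.law x₀ y))) := fun x => by
    rw [Fintype.sum_prod_apply fun i y => W.law (x i) y *
      Real.exp (-(s * Real.log (W.law (x i) y / W.law x₀ y))), Finset.prod_mul_distrib]
  simp_rw [e]
  exact (Fintype.sum_pow (fun x => P x * ∑ y, W.law x y *
    Real.exp (-(s * Real.log (W.law x y / W.law x₀ y)))) n).symm

/-- The second moment of the likelihood ratio under `Q₀` is `1 + chiSq`, and it is multiplicative
over letters. -/
theorem sum_sq_output_div [DecidableEq Y] (h0 : ∀ y, 0 < W.law x₀ y) {n : ℕ} {P : X → ℝ}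
    (hP : P ∈ stdSimplex ℝ X) :
    ∑ y : Fin n → Y, (∏ i, W.output P (y i)) * (∏ i, W.output P (y i)) /
      W.blockLaw (fun _ => x₀) y = (1 + chiSq (W.output P) (W.law x₀)) ^ n := by
  have e : 1 + chiSq (W.output P) (W.law x₀) =
      ∑ y, W.output P y * W.output P y / W.law x₀ y := by
    have h1 : ∀ y, (W.output P y - W.law x₀ y) ^ 2 / W.law x₀ y =
        W.output P y * W.output P y / W.law x₀ y - 2 * W.output P y + W.law x₀ y := fun y => by
      have := (h0 y).ne'
      field_simp
      ring
    rw [chiSq]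
    simp_rw [h1, Finset.sum_add_distrib, Finset.sum_sub_distrib, ← Finset.mul_sum,
      (W.output_mem hP).2, W.sum_law]
    ring
  rw [e, Fintype.sum_pow]
  simp_rw [blockLaw, ← Finset.prod_mul_distrib, ← Finset.prod_div_distrib]

theorem exists_errorProb_iidCode_le [DecidableEq Y] (h0 : ∀ y, 0 < W.law x₀ y) {n m : ℕ}
    (hm : 0 < m) {P : X → ℝ} (hP : P ∈ stdSimplex ℝ X) {s : ℝ} (hs : 0 ≤ s) (g : ℝ) :
    ∃ dec : (Fin m → Fin n → X) → (Fin n → Y) → Fin m, W.errorProb (iidCode P dec) ≤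
      Real.exp (s * g) * W.negMGF x₀ P s ^ n +
        m * (Real.exp (-g) * (1 + chiSq (W.output P) (W.law x₀)) ^ n) := by
  classical
  have : Nonempty (Fin m) := ⟨⟨0, hm⟩⟩
  have hm' : (0 : ℝ) < m := by exact_mod_cast hm
  let T (x : Fin n → X) (y : Fin n → Y) : ℝ := ∏ i, W.law (x i) (y i) *
    Real.exp (-(s * Real.log (W.law (x i) (y i) / W.law x₀ (y i))))
  let Q (y : Fin n → Y) : ℝ := W.blockLaw (fun _ => x₀) y
  have hT : ∀ x y, 0 ≤ T x y := fun x y =>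
    Finset.prod_nonneg fun i _ => mul_nonneg (W.law_nonneg _ _) (Real.exp_pos _).le
  have hQ : ∀ y, 0 < Q y := W.blockLaw_pos x₀ h0
  let dec (e : Fin m → Fin n → X) : (Fin n → Y) → Fin m :=
    uniqueDecoder fun j y => Real.exp g * Q y < W.blockLaw (e j) y
  have hpair : ∀ (e : Fin m → Fin n → X) j k y,
      0 ≤ W.blockLaw (e j) y * W.blockLaw (e k) y / (Real.exp g * Q y) := fun e j k y =>
    div_nonneg (mul_nonneg (W.blockLaw_nonneg _ _) (W.blockLaw_nonneg _ _))
      (mul_pos (Real.exp_pos g) (hQ y)).le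
  -- An error means that the sent codeword misses the threshold (first term) or that some other `k`
  -- passes it; in the latter case `1 ≤ W.blockLaw (e k) y / (exp g * Q y)`.
  have hpt : ∀ (e : Fin m → Fin n → X) j y, dec e y ≠ j → W.blockLaw (e j) y ≤
      Real.exp (s * g) * T (e j) y + ∑ k ∈ Finset.univ.erase j,
        W.blockLaw (e j) y * W.blockLaw (e k) y / (Real.exp g * Q y) := by
    intro e j y hne
    have hnn := Finset.sum_nonneg fun k (_ : k ∈ Finset.univ.erase j) => hpair e j k y
    by_cases hg : Real.exp g * Q y < W.blockLaw (e j) y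
    · obtain ⟨k, hkj, hk⟩ := exists_good_of_uniqueDecoder_ne
        (good := fun j y => Real.exp g * Q y < W.blockLaw (e j) y) hg hne
      have h1 : W.blockLaw (e j) y ≤
          W.blockLaw (e j) y * W.blockLaw (e k) y / (Real.exp g * Q y) := by
        rw [mul_div_assoc]
        exact le_mul_of_one_le_right (W.blockLaw_nonneg _ _)
          ((one_le_div (mul_pos (Real.exp_pos g) (hQ y))).2 hk.le)
      have h2 := Finset.single_le_sum (fun k _ => hpair e j k y)
        (Finset.mem_erase.2 ⟨hkj, Finset.mem_univ k⟩)
      have h3 := mul_nonneg (Real.exp_pos (s * g)).le (hT (e j) y)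
      linarith
    · have := W.blockLaw_le_chernoff h0 hs (not_lt.1 hg)
      exact this.trans (le_add_of_nonneg_right hnn)
  have hsum : ∀ (e : Fin m → Fin n → X) j, ∑ y with dec e y ≠ j, W.blockLaw (e j) y ≤
      Real.exp (s * g) * ∑ y, T (e j) y + ∑ k ∈ Finset.univ.erase j,
        ∑ y, W.blockLaw (e j) y * W.blockLaw (e k) y / (Real.exp g * Q y) := by
    intro e j
    rw [Finset.sum_comm, Finset.mul_sum, ← Finset.sum_add_distrib]
    refine (Finset.sum_le_sum fun y hy => hpt e j y (Finset.mem_filter.1 hy).2).trans ?_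
    exact Finset.sum_le_sum_of_subset_of_nonneg (Finset.filter_subset _ _) fun y _ _ =>
      add_nonneg (mul_nonneg (Real.exp_pos _).le (hT _ _))
        (Finset.sum_nonneg fun k _ => hpair e j k y)
  have hw : ∀ e : Fin m → Fin n → X, 0 ≤ ∏ j, ∏ i, P (e j i) := fun e =>
    Finset.prod_nonneg fun j _ => Finset.prod_nonneg fun i _ => hP.1 _
  set A := Real.exp (s * g) * W.negMGF x₀ P s ^ n with hA
  set B := Real.exp (-g) * (1 + chiSq (W.output P) (W.law x₀)) ^ n with hB
  have hB0 : 0 ≤ B := mul_nonneg (Real.exp_pos _).le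
    (pow_nonneg (by linarith [chiSq_nonneg (q := W.output P) h0]) n)
  have hone : ∀ j, ∑ e : Fin m → Fin n → X, (∏ j, ∏ i, P (e j i)) *
      (Real.exp (s * g) * ∑ y, T (e j) y) = A := by
    intro j
    simp_rw [mul_left_comm _ (Real.exp (s * g)), ← Finset.mul_sum]
    rw [sum_prod_mul_apply (p := fun x : Fin n → X => ∏ i, P (x i)) (sum_prod_iid hP) j
      fun x => ∑ y, T x y, W.sum_prod_mul_chernoff]
  -- Two distinct codewords are independent, so the product of their block laws averages to the
  -- squared output law.
  have htwo : ∀ j, ∀ k ≠ j, ∑ e : Fin m → Fin n → X, (∏ j, ∏ i, P (e j i)) *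
      ∑ y, W.blockLaw (e j) y * W.blockLaw (e k) y / (Real.exp g * Q y) = B := by
    intro j k hkj
    simp_rw [Finset.mul_sum]
    rw [Finset.sum_comm, hB, ← W.sum_sq_output_div h0 hP, Finset.mul_sum]
    refine Finset.sum_congr rfl fun y _ => ?_
    simp_rw [← mul_div_assoc, ← Finset.sum_div]
    rw [sum_prod_mul_apply_mul_apply (p := fun x : Fin n → X => ∏ i, P (x i))
      (sum_prod_iid hP) hkj.symm (fun x => W.blockLaw x y) (fun x => W.blockLaw x y),
      sum_prod_mul_blockLaw, Real.exp_neg]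
    have := (hQ y).ne'
    change _ / (_ * Q y) = _ / Q y
    field_simp
  have hj : ∀ j, ∑ e : Fin m → Fin n → X, (∏ j, ∏ i, P (e j i)) *
      ∑ y with dec e y ≠ j, W.blockLaw (e j) y ≤ A + m * B := by
    intro j
    refine (Finset.sum_le_sum fun e _ => mul_le_mul_of_nonneg_left (hsum e j) (hw e)).trans ?_
    simp_rw [mul_add, Finset.sum_add_distrib]
    rw [hone j]
    simp_rw [Finset.mul_sum (Finset.univ.erase j)]
    rw [Finset.sum_comm, Finset.sum_congr rfl fun k hk => htwo j k (Finset.ne_of_mem_erase hk),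
      Finset.sum_const, nsmul_eq_mul]
    have hc : ((Finset.univ.erase j).card : ℝ) ≤ m := by
      exact_mod_cast (Finset.card_le_univ _).trans_eq (Fintype.card_fin m)
    linarith [mul_le_mul_of_nonneg_right hc hB0]
  refine ⟨dec, ?_⟩
  rw [errorProb, sum_iidCode_mul]
  simp_rw [← mul_div_assoc, ← Finset.sum_div, Finset.mul_sum (Finset.univ : Finset (Fin m))]
  rw [Finset.sum_comm, div_le_iff₀ hm']
  refine (Finset.sum_le_sum fun j _ => hj j).trans_eq ?_
  simp only [Finset.sum_const, Finset.card_univ, Fintype.card_fin, nsmul_eq_mul]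
  ring

/-! ### Converse -/

/-- The average of the letter distributions of the codewords of a random code. -/
noncomputable def letterDist [DecidableEq Y] {n m : ℕ} (C : Code X Y n m → ℝ) (x : X) : ℝ :=
  open Classical in
  (∑ c, C c * ((∑ j, ∑ i : Fin n, if c.1 j i = x then (1 : ℝ) else 0) / m)) / n

theorem sum_letterDist_mul [DecidableEq Y] {n m : ℕ} (C : Code X Y n m → ℝ) (f : X → ℝ) :
    ∑ x, letterDist C x * f x =
      (∑ c, C c * ((∑ j, ∑ i : Fin n, f (c.1 j i)) / m)) / n := by
  classical
  simp_rw [letterDist, div_mul_eq_mul_div, ← Finset.sum_div, Finset.sum_mul]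
  rw [Finset.sum_comm]
  congr 1
  refine Finset.sum_congr rfl fun c _ => ?_
  simp_rw [mul_assoc, ← Finset.mul_sum, div_mul_eq_mul_div, ← Finset.sum_div, Finset.sum_mul]
  congr 2
  rw [Finset.sum_comm]
  refine Finset.sum_congr rfl fun j _ => ?_
  rw [Finset.sum_comm]
  refine Finset.sum_congr rfl fun i _ => ?_
  simp

theorem letterDist_mem [DecidableEq Y] {n m : ℕ} (hn : 0 < n) (hm : 0 < m)
    {C : Code X Y n m → ℝ} (hC : C ∈ stdSimplex ℝ (Code X Y n m)) :
    letterDist C ∈ stdSimplex ℝ X := by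
  have hn' : (n : ℝ) ≠ 0 := by positivity
  have hm' : (m : ℝ) ≠ 0 := by positivity
  constructor
  · intro x
    refine div_nonneg (Finset.sum_nonneg fun c _ => mul_nonneg (hC.1 c) (div_nonneg
      (Finset.sum_nonneg fun j _ => Finset.sum_nonneg fun i _ => ?_) m.cast_nonneg))
      n.cast_nonneg
    split_ifs <;> norm_num
  · have := sum_letterDist_mul C fun _ => 1
    simp only [mul_one] at this
    rw [this]
    simp only [Finset.sum_const, Finset.card_univ, Fintype.card_fin, nsmul_eq_mul, mul_one]
    rw [mul_div_cancel_left₀ _ hm', ← Finset.sum_mul, hC.2, one_mul, div_self hn']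

theorem codeOutput_mem [DecidableEq Y] {n m : ℕ} (hm : 0 < m)
    {C : Code X Y n m → ℝ} (hC : C ∈ stdSimplex ℝ (Code X Y n m)) :
    W.codeOutput C ∈ stdSimplex ℝ (Fin n → Y) := by
  have hm' : (m : ℝ) ≠ 0 := by positivity
  refine ⟨fun y => Finset.sum_nonneg fun c _ => mul_nonneg (hC.1 c) (div_nonneg
    (Finset.sum_nonneg fun j _ => W.blockLaw_nonneg _ _) m.cast_nonneg), ?_⟩
  simp only [codeOutput]
  rw [Finset.sum_comm]
  simp_rw [← Finset.mul_sum, ← Finset.sum_div]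
  rw [← hC.2]
  refine Finset.sum_congr rfl fun c _ => ?_
  rw [Finset.sum_comm]
  simp_rw [W.sum_blockLaw]
  simp [hm']

/-- Expectations of additive functions of the output block see only its letter marginals, hence only
their average. -/
theorem sum_codeOutput_mul_sum [DecidableEq Y] {n m : ℕ} (hn : 0 < n)
    (C : Code X Y n m → ℝ) (f : Y → ℝ) :
    ∑ y, W.codeOutput C y * ∑ i, f (y i) = n * ∑ y, W.output (letterDist C) y * f y := by
  have hn' : (n : ℝ) ≠ 0 := by positivity
  have e : ∑ y, W.output (letterDist C) y * f y =
      ∑ x, letterDist C x * ∑ y, W.law x y * f y := by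
    simp_rw [output, Finset.sum_mul, Finset.mul_sum]
    rw [Finset.sum_comm]
    simp_rw [mul_assoc]
  rw [e, sum_letterDist_mul, mul_div_cancel₀ _ hn']
  simp_rw [codeOutput, Finset.sum_mul]
  rw [Finset.sum_comm]
  refine Finset.sum_congr rfl fun c _ => ?_
  simp_rw [mul_assoc, ← Finset.mul_sum, div_mul_eq_mul_div, ← Finset.sum_div, Finset.sum_mul]
  congr 2
  rw [Finset.sum_comm]
  refine Finset.sum_congr rfl fun j _ => ?_
  simp_rw [Finset.mul_sum]
  rw [Finset.sum_comm]
  refine Finset.sum_congr rfl fun i _ => ?_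
  exact sum_prod_mul_apply_of_forall (fun i => W.sum_law (c.1 j i)) i f

/-- The absolute continuity needed for Gibbs' inequality: a letter that never occurs on average has
probability zero at each position. -/
theorem codeOutput_eq_zero [DecidableEq Y] {n m : ℕ} (hn : 0 < n) (hm : 0 < m)
    {C : Code X Y n m → ℝ} (hC : C ∈ stdSimplex ℝ (Code X Y n m)) {y : Fin n → Y}
    (hy : ∏ i, W.output (letterDist C) (y i) = 0) : W.codeOutput C y = 0 := by
  obtain ⟨i, _, hi⟩ := Finset.prod_eq_zero_iff.1 hy
  have h := W.sum_codeOutput_mul_sum hn C fun z => if z = y i then 1 else 0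
  simp only [mul_ite, mul_one, mul_zero, Finset.sum_ite_eq', Finset.mem_univ, if_true, hi] at h
  have hind : ∀ z : Fin n → Y, ∀ k, (0 : ℝ) ≤ if z k = y i then 1 else 0 := fun z k => by
    split_ifs <;> norm_num
  have h0 := (Finset.sum_eq_zero_iff_of_nonneg fun z _ => mul_nonneg
    ((W.codeOutput_mem hm hC).1 z) (Finset.sum_nonneg fun k _ => hind z k)).1 h y
    (Finset.mem_univ y)
  refine (mul_eq_zero.1 h0).resolve_right (ne_of_gt ?_)
  refine lt_of_lt_of_le one_pos ?_
  have := Finset.single_le_sum (fun k _ => hind y k) (Finset.mem_univ i)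
  simpa using this

/-- The letter-averaged output distribution satisfies the single-letter divergence constraint. -/
theorem mul_realKL_letterDist_le [DecidableEq Y] (h0 : ∀ y, 0 < W.law x₀ y) {n m : ℕ}
    (hn : 0 < n) (hm : 0 < m) {C : Code X Y n m → ℝ} (hC : C ∈ stdSimplex ℝ (Code X Y n m)) :
    n * realKL (W.output (letterDist C)) (W.law x₀) ≤
      realKL (W.codeOutput C) (W.blockLaw fun _ : Fin n => x₀) := by
  have hQ := W.output_mem (letterDist_mem hn hm hC)
  have hq := W.codeOutput_mem hm hC
  have hg := sum_mul_log_div_nonneg hq (prod_mem_stdSimplex (ι := Fin n) fun _ => hQ)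
    fun y hy => W.codeOutput_eq_zero hn hm hC hy
  rw [realKL, ← W.sum_codeOutput_mul_sum hn]
  -- Pointwise form of `D(Qⁿ ‖ Q₀ⁿ) = D(Qⁿ ‖ Q̄ⁿ) + n D(Q̄ ‖ Q₀)`, with `Q̄` the averaged letter
  -- output; the first term is nonnegative by `hg`.
  have e : ∀ y, W.codeOutput C y *
      Real.log (W.codeOutput C y / W.blockLaw (fun _ : Fin n => x₀) y) =
      W.codeOutput C y * Real.log (W.codeOutput C y / ∏ i, W.output (letterDist C) (y i)) +
      W.codeOutput C y * ∑ i, Real.log (W.output (letterDist C) (y i) / W.law x₀ (y i)) := by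
    intro y
    by_cases hz : W.codeOutput C y = 0
    · simp [hz]
    have hp : ∏ i, W.output (letterDist C) (y i) ≠ 0 := fun h =>
      hz (W.codeOutput_eq_zero hn hm hC h)
    have hb := (W.blockLaw_pos x₀ h0 y).ne'
    rw [← Real.log_prod fun i _ =>
        div_ne_zero (Finset.prod_ne_zero_iff.1 hp i (Finset.mem_univ i)) (h0 _).ne',
      Finset.prod_div_distrib]
    change _ = _ + _ * Real.log (_ / W.blockLaw (fun _ => x₀) y)
    rw [Real.log_div hz hb, Real.log_div hz hp, Real.log_div hp hb]
    ring
  rw [realKL]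
  simp_rw [e, Finset.sum_add_distrib]
  exact le_add_of_nonneg_left hg

/-- The variational bound with test function `log m` on the decoding region of `j` and `0`
elsewhere. The regions partition the output space, so summed over `j` the exponential moments under
`Q₀` total at most `2 * m`; one `m` cancels against the total mass of the block laws. -/
theorem log_card_le_sum_realKL {X Y : Type*} [Fintype Y] [DecidableEq Y] (W : DMC X Y) {x₀ : X}
    (h0 : ∀ y, 0 < W.law x₀ y) {n m : ℕ}
    (hm : 0 < m) (c : Code X Y n m) :
    m * Real.log m - Real.log m * ∑ j, ∑ y with c.2 y ≠ j, W.blockLaw (c.1 j) y - m ≤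
      ∑ j, ∑ i, realKL (W.law (c.1 j i)) (W.law x₀) := by
  have hm' : (0 : ℝ) < m := by exact_mod_cast hm
  have hpt : ∀ j y, W.blockLaw (c.1 j) y * Real.log m -
      (if c.2 y ≠ j then W.blockLaw (c.1 j) y else 0) * Real.log m + W.blockLaw (c.1 j) y -
      W.blockLaw (fun _ => x₀) y - (if j = c.2 y then W.blockLaw (fun _ => x₀) y * m else 0) ≤
      W.blockLaw (c.1 j) y *
        Real.log (W.blockLaw (c.1 j) y / W.blockLaw (fun _ => x₀) y) := by
    intro j y
    have hb := W.blockLaw_pos x₀ h0 y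
    have h := mul_log_div_ge (W.blockLaw_nonneg (c.1 j) y) hb
      (if j = c.2 y then Real.log m else 0)
    by_cases hj : j = c.2 y
    · rw [if_pos hj, Real.exp_log hm'] at h
      rw [if_neg (not_not.2 hj.symm), if_pos hj]
      linarith
    · rw [if_neg hj, Real.exp_zero] at h
      rw [if_pos (Ne.symm hj), if_neg hj]
      linarith
  have hsum := Finset.sum_le_sum fun j (_ : j ∈ Finset.univ) =>
    Finset.sum_le_sum fun y (_ : y ∈ Finset.univ) => hpt j y
  simp only [Finset.sum_add_distrib, Finset.sum_sub_distrib, ← Finset.sum_mul, W.sum_blockLaw]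
    at hsum
  rw [Finset.sum_comm (f := fun (j : Fin m) (y : Fin n → Y) =>
    if j = c.2 y then W.blockLaw (fun _ => x₀) y * (m : ℝ) else 0)] at hsum
  simp only [Finset.sum_ite_eq', Finset.mem_univ, if_true, ← Finset.sum_mul, W.sum_blockLaw,
    Finset.sum_const, Finset.card_univ, Fintype.card_fin, nsmul_eq_mul, one_mul, mul_one]
    at hsum
  have hr : ∀ j, ∑ y, W.blockLaw (c.1 j) y *
      Real.log (W.blockLaw (c.1 j) y / W.blockLaw (fun _ => x₀) y) =
      ∑ i, realKL (W.law (c.1 j i)) (W.law x₀) := fun j =>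
    realKL_prod (fun i => W.sum_law (c.1 j i)) h0
  simp_rw [hr] at hsum
  simp_rw [Finset.sum_filter]
  linarith

/-- The converse: the size of an achievable message set is bounded by a mean divergence. -/
theorem Achievable.exists_log_le [DecidableEq Y] {W : DMC X Y} (h0 : ∀ y, 0 < W.law x₀ y)
    {n m : ℕ} (hn : 0 < n) {δ ε : ℝ} (h : W.Achievable x₀ n δ ε m) :
    ∃ P ∈ W.admissible x₀ (δ / n), (1 - ε) * Real.log m ≤ n * W.meanDiv x₀ P + 1 := by
  obtain ⟨hm, C, hC, hD, hE⟩ := h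
  have hn' : (0 : ℝ) < n := by exact_mod_cast hn
  have hm' : (0 : ℝ) < m := by exact_mod_cast hm
  rw [relEntropy_eq_realKL (W.blockLaw_pos x₀ h0), EReal.coe_le_coe_iff] at hD
  refine ⟨letterDist C, (W.mem_admissible_iff h0).2 ⟨letterDist_mem hn hm hC, ?_⟩, ?_⟩
  · rw [le_div_iff₀ hn', mul_comm]
    exact (W.mul_realKL_letterDist_le h0 hn hm hC).trans hD
  · rw [meanDiv, sum_letterDist_mul, mul_div_cancel₀ _ hn'.ne']
    have h1 : Real.log m - Real.log m * W.errorProb C - 1 ≤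
        ∑ c, C c * ((∑ j, ∑ i, realKL (W.law (c.1 j i)) (W.law x₀)) / m) := by
      have e : Real.log m - Real.log m * W.errorProb C - 1 =
          ∑ c, C c * ((m * Real.log m -
            Real.log m * ∑ j, ∑ y with c.2 y ≠ j, W.blockLaw (c.1 j) y - m) / m) := by
        have e1 : ∀ c : Code X Y n m, C c * ((m * Real.log m -
            Real.log m * ∑ j, ∑ y with c.2 y ≠ j, W.blockLaw (c.1 j) y - m) / m) =
            C c * (Real.log m - 1) - Real.log m *
              (C c * ((∑ j, ∑ y with c.2 y ≠ j, W.blockLaw (c.1 j) y) / m)) := fun c => by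
          field_simp
          ring
        simp_rw [e1, Finset.sum_sub_distrib, ← Finset.mul_sum, ← Finset.sum_mul, hC.2]
        rw [errorProb]
        ring
      rw [e]
      exact Finset.sum_le_sum fun c _ => mul_le_mul_of_nonneg_left
        (div_le_div_of_nonneg_right (W.log_card_le_sum_realKL h0 hm c) hm'.le) (hC.1 c)
    have h2 := mul_le_mul_of_nonneg_left hE (Real.log_nonneg (x := m) (by exact_mod_cast hm))
    linarith

end DMC

namespace DMC

variable {X Y : Type*} [Fintype X] [Fintype Y] (W : DMC X Y) (x₀ : X)

/-! ### The normalized rates of mixtures with the off symbol -/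

/-- The rates, in units of `√(n δ)`, of the input distributions which send `x₀` with probability
`1 - κ / √n` and are `P` otherwise, for those `κ` and `P` that meet the divergence constraint to
second order. -/
def rateSet (δ : ℝ) : Set ℝ :=
  {v | ∃ P ∈ stdSimplex ℝ X, ∃ κ : ℝ, 0 ≤ κ ∧
    κ ^ 2 * chiSq (W.output P) (W.law x₀) < 2 * δ ∧ v = κ * W.meanDiv x₀ P / √δ}

theorem zero_mem_rateSet {δ : ℝ} (hδ : 0 < δ) : 0 ∈ W.rateSet x₀ δ :=
  ⟨pointMass x₀, pointMass_mem x₀, 0, le_rfl, by simpa using hδ, by simp⟩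

variable {x₀}

theorem tendsto_const_div_sqrt (κ : ℝ) :
    Tendsto (fun n : ℕ => κ / √(n : ℝ)) atTop (𝓝 0) :=
  (Real.tendsto_sqrt_atTop.comp tendsto_natCast_atTop_atTop).const_div_atTop κ

theorem eventually_mixture_mem_admissible (h0 : ∀ y, 0 < W.law x₀ y) {δ : ℝ}
    {P : X → ℝ} (hP : P ∈ stdSimplex ℝ X) {κ : ℝ} (hκ : 0 ≤ κ)
    (h : κ ^ 2 * chiSq (W.output P) (W.law x₀) < 2 * δ) :
    ∀ᶠ n : ℕ in atTop, κ / √n < 1 ∧ mixture x₀ P (κ / √n) ∈ W.admissible x₀ (δ / n) := by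
  have ht := tendsto_const_div_sqrt κ
  have h1 : Tendsto (fun n : ℕ => 2 * δ * (1 - κ / √(n : ℝ))) atTop (𝓝 (2 * δ)) := by
    simpa using (ht.const_sub 1).const_mul (2 * δ)
  filter_upwards [h1.eventually_const_lt h, ht.eventually_lt_const one_pos,
    eventually_gt_atTop 0] with n hn ha hn0
  have hn' : (0 : ℝ) < n := by exact_mod_cast hn0
  have ha0 : 0 ≤ κ / √(n : ℝ) := div_nonneg hκ (Real.sqrt_nonneg _)
  refine ⟨ha, (W.mem_admissible_iff h0).2 ⟨mixture_mem x₀ hP ha0 ha.le, ?_⟩⟩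
  refine (W.realKL_output_mixture_le h0 hP ha0 ha).trans ?_
  have h1a : 0 < 1 - κ / √(n : ℝ) := sub_pos.2 ha
  rw [div_le_div_iff₀ (by linarith) hn', div_pow, Real.sq_sqrt hn'.le]
  have e : κ ^ 2 / n * chiSq (W.output P) (W.law x₀) * n =
      κ ^ 2 * chiSq (W.output P) (W.law x₀) := by
    field_simp
  rw [e]
  linarith

/-- An admissible `P` is itself used as the direction, with `κ = √n / η`. Since `chiSq ≤ 2 * η * δ /
n` eventually, `κ ^ 2 * chiSq ≤ 2 * δ / η`, which is strictly below `2 * δ`. -/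
theorem eventually_meanDiv_le (h0 : ∀ y, 0 < W.law x₀ y) {δ : ℝ} (hδ : 0 < δ) {η : ℝ}
    (hη : 1 < η) :
    ∀ᶠ n : ℕ in atTop, ∀ P ∈ W.admissible x₀ (δ / n),
      ∃ v ∈ W.rateSet x₀ δ, √n / √δ * W.meanDiv x₀ P ≤ η * v := by
  obtain ⟨r₀, hr₀, hr⟩ := exists_chiSq_le_of_realKL_le h0 (W.sum_law x₀) hη
  filter_upwards [(tendsto_const_div_atTop_nhds_zero_nat δ).eventually_le_const hr₀,
    eventually_gt_atTop 0] with n hn hn0 P hP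
  have hn' : (0 : ℝ) < n := by exact_mod_cast hn0
  have hη0 : 0 < η := one_pos.trans hη
  rw [W.mem_admissible_iff h0] at hP
  have h1 := hr _ (W.output_mem hP.1) (hP.2.trans hn)
  refine ⟨_, ⟨P, hP.1, √n / η, by positivity, ?_, rfl⟩, le_of_eq (by field_simp)⟩
  have h2 : chiSq (W.output P) (W.law x₀) ≤ 2 * η * (δ / n) :=
    h1.trans (mul_le_mul_of_nonneg_left hP.2 (by linarith))
  calc (√n / η) ^ 2 * chiSq (W.output P) (W.law x₀) ≤ (√n / η) ^ 2 * (2 * η * (δ / n)) :=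
        mul_le_mul_of_nonneg_left h2 (sq_nonneg _)
    _ = 2 * δ / η := by
        rw [div_pow, Real.sq_sqrt hn'.le]
        field_simp
    _ < 2 * δ := div_lt_self (by linarith) hη

/-! ### Achievability -/

/-- The off symbol has zero log-likelihood ratio and contributes exactly 1, so only the fraction `a`
moves the exponent; there the exponential is expanded to second order, with `M` bounding all log
ratios. -/
theorem exists_negMGF_mixture_le {P : X → ℝ} (hP : P ∈ stdSimplex ℝ X) :
    ∃ M > 0, ∀ s a, 0 ≤ s → s * M ≤ 1 → 0 ≤ a → a ≤ 1 →
      W.negMGF x₀ (mixture x₀ P a) s ≤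
        Real.exp (a * (-(s * W.meanDiv x₀ P) + s ^ 2 * M ^ 2)) := by
  let f (x : X) (y : Y) : ℝ := Real.log (W.law x y / W.law x₀ y)
  have hM : ∀ x y, |f x y| ≤ 1 + ∑ x, ∑ y, |f x y| := fun x y => by
    have h1 := Finset.single_le_sum (f := fun y => |f x y|) (fun y _ => abs_nonneg _)
      (Finset.mem_univ y)
    have h2 := Finset.single_le_sum (f := fun x => ∑ y, |f x y|)
      (fun x _ => Finset.sum_nonneg fun y _ => abs_nonneg (f x y)) (Finset.mem_univ x)
    linarith
  have hM0 : 0 < 1 + ∑ x, ∑ y, |f x y| :=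
    add_pos_of_pos_of_nonneg one_pos
      (Finset.sum_nonneg fun x _ => Finset.sum_nonneg fun y _ => abs_nonneg _)
  set M := 1 + ∑ x, ∑ y, |f x y|
  refine ⟨M, hM0, fun s a hs hsM ha ha1 => ?_⟩
  have hexp : ∀ x y, Real.exp (-(s * f x y)) ≤ 1 - s * f x y + s ^ 2 * M ^ 2 := by
    intro x y
    have h1 : |-(s * f x y)| ≤ s * M := by
      rw [abs_neg, abs_mul, abs_of_nonneg hs]
      exact mul_le_mul_of_nonneg_left (hM x y) hs
    have h2 := (abs_le.1 (Real.abs_exp_sub_one_sub_id_le (h1.trans hsM))).2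
    have h3 : (-(s * f x y)) ^ 2 ≤ (s * M) ^ 2 := by
      rw [← sq_abs (-(s * f x y))]
      exact pow_le_pow_left₀ (abs_nonneg _) h1 2
    rw [mul_pow] at h3
    linarith
  have hx : ∀ x, ∑ y, W.law x y * Real.exp (-(s * f x y)) ≤
      1 - s * realKL (W.law x) (W.law x₀) + s ^ 2 * M ^ 2 := by
    intro x
    refine (Finset.sum_le_sum fun y _ =>
      mul_le_mul_of_nonneg_left (hexp x y) (W.law_nonneg x y)).trans_eq ?_
    have e : ∀ y, W.law x y * (1 - s * f x y + s ^ 2 * M ^ 2) =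
        W.law x y * (1 + s ^ 2 * M ^ 2) - s * (W.law x y * f x y) := fun y => by ring
    simp_rw [e, Finset.sum_sub_distrib, ← Finset.sum_mul, ← Finset.mul_sum, W.sum_law]
    change _ - s * realKL (W.law x) (W.law x₀) = _
    ring
  have hx0 : ∑ y, W.law x₀ y * Real.exp (-(s * f x₀ y)) = 1 := by
    rw [← W.sum_law x₀]
    refine Finset.sum_congr rfl fun y _ => ?_
    simp [f]
  have hsum := Finset.sum_le_sum fun x (_ : x ∈ Finset.univ) =>
    mul_le_mul_of_nonneg_left (hx x) (hP.1 x)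
  have e : ∑ x, P x * (1 - s * realKL (W.law x) (W.law x₀) + s ^ 2 * M ^ 2) =
      1 - s * W.meanDiv x₀ P + s ^ 2 * M ^ 2 := by
    have e1 : ∀ x, P x * (1 - s * realKL (W.law x) (W.law x₀) + s ^ 2 * M ^ 2) =
        P x * (1 + s ^ 2 * M ^ 2) - s * (P x * realKL (W.law x) (W.law x₀)) := fun x => by ring
    simp_rw [e1, Finset.sum_sub_distrib, ← Finset.sum_mul, ← Finset.mul_sum, hP.2]
    rw [meanDiv]
    ring
  rw [e] at hsum
  have h1 := mul_le_mul_of_nonneg_left hsum ha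
  have h2 := Real.add_one_le_exp (a * (-(s * W.meanDiv x₀ P) + s ^ 2 * M ^ 2))
  rw [negMGF, sum_mixture_mul]
  change (1 - a) * (∑ y, W.law x₀ y * Real.exp (-(s * f x₀ y))) + _ ≤ _
  rw [hx0]
  linarith

theorem achievable_one [DecidableEq Y] (h0 : ∀ y, 0 < W.law x₀ y) {δ ε : ℝ} (hδ : 0 ≤ δ)
    (hε : 0 ≤ ε) (n : ℕ) : W.Achievable x₀ n δ ε 1 := by
  refine ⟨one_pos, iidCode (pointMass x₀) fun _ _ => 0, iidCode_mem (pointMass_mem x₀) _, ?_, ?_⟩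
  · rw [W.relEntropy_codeOutput_iidCode x₀ h0 one_pos (pointMass_mem x₀), output_pointMass,
      realKL_self, mul_zero]
    exact_mod_cast hδ
  · refine le_of_eq_of_le ?_ hε
    rw [errorProb]
    refine Finset.sum_eq_zero fun c _ => ?_
    simp [Subsingleton.elim (c.2 _) (0 : Fin 1)]

theorem tendsto_exp_neg_mul_sqrt {c : ℝ} (hc : 0 < c) (K : ℝ) :
    Tendsto (fun n : ℕ => K * Real.exp (-(c * √(n : ℝ)))) atTop (𝓝 0) := by
  have h := (Real.tendsto_sqrt_atTop.comp tendsto_natCast_atTop_atTop).const_mul_atTop hc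
  simpa using (Real.tendsto_exp_neg_atTop_nhds_zero.comp h).const_mul K

theorem eventually_exists_achievable [DecidableEq Y] (h0 : ∀ y, 0 < W.law x₀ y) {δ : ℝ}
    (hδ : 0 < δ) {ε : ℝ} (hε : 0 < ε) {v v' : ℝ} (hv : v ∈ W.rateSet x₀ δ) (hv' : v' < v) :
    ∀ᶠ n : ℕ in atTop, ∃ m, W.Achievable x₀ n δ ε m ∧ v' * √(n * δ) ≤ Real.log m := by
  -- One message suffices for a nonpositive target. Otherwise the target exponential is at least 1,
  -- so rounding it up to an integer costs at most a factor 2.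
  rcases le_or_gt v' 0 with hneg | hpos
  · refine Eventually.of_forall fun n => ⟨1, W.achievable_one h0 hδ.le hε.le n, ?_⟩
    rw [Nat.cast_one, Real.log_one]
    exact mul_nonpos_of_nonpos_of_nonneg hneg (Real.sqrt_nonneg _)
  obtain ⟨P, hP, κ, hκ0, hκ, rfl⟩ := hv
  have hsδ : 0 < √δ := Real.sqrt_pos.2 hδ
  have hκpos : 0 < κ := hκ0.lt_of_ne fun h => by
    rw [← h, zero_mul, zero_div] at hv'
    linarith
  -- The threshold rate `u` lies strictly between the code rate `v'` and the limit `v`; the two gaps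
  -- make the two error terms decay exponentially in `√n`.
  obtain ⟨u, hu', hu⟩ := exists_between hv'
  obtain ⟨M, hM, hmgf⟩ := W.exists_negMGF_mixture_le hP
  set d := κ * W.meanDiv x₀ P - u * √δ with hd
  have hd0 : 0 < d := by
    rw [lt_div_iff₀ hsδ] at hu
    linarith
  -- The Chernoff exponent will be `-s * (d - s * κ * M ^ 2) * √n`, so `s` must be small enough for
  -- the linear gain `d` to dominate.
  obtain ⟨s, hs, hsM, hsd⟩ : ∃ s > 0, s * M ≤ 1 ∧ s * (κ * M ^ 2) < d := by
    refine ⟨d / (κ * M ^ 2 + d * M), by positivity, ?_, ?_⟩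
    · rw [div_mul_eq_mul_div, div_le_one (by positivity)]
      linarith [show 0 < κ * M ^ 2 by positivity]
    · rw [div_mul_eq_mul_div, div_lt_iff₀ (by positivity)]
      have : 0 < d * (d * M) := by positivity
      linarith
  set K := Real.exp (κ ^ 2 * chiSq (W.output P) (W.law x₀)) with hK
  have hl1 := tendsto_exp_neg_mul_sqrt (mul_pos hs (sub_pos.2 hsd)) 1
  have hl2 := tendsto_exp_neg_mul_sqrt (mul_pos (sub_pos.2 hu') hsδ) (2 * K)
  filter_upwards [W.eventually_mixture_mem_admissible h0 hP hκ0 hκ, eventually_gt_atTop 0,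
    hl1.eventually_le_const (half_pos hε), hl2.eventually_le_const (half_pos hε)]
    with n hadm hn0 h1 h2
  obtain ⟨ha1, hadm⟩ := hadm
  have hn' : (0 : ℝ) < n := by exact_mod_cast hn0
  have hsn : 0 < √(n : ℝ) := Real.sqrt_pos.2 hn'
  rw [W.mem_admissible_iff h0, le_div_iff₀ hn'] at hadm
  rw [Real.sqrt_mul hn'.le]
  set a := κ / √(n : ℝ) with ha
  have ha0 : 0 ≤ a := by positivity
  have hna : n * a = κ * √n := by
    rw [ha]
    nth_rewrite 1 [← Real.mul_self_sqrt hn'.le]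
    field_simp
  set m := ⌈Real.exp (v' * (√n * √δ))⌉₊ with hm
  have hmlow : Real.exp (v' * (√n * √δ)) ≤ m := Nat.le_ceil _
  have hm0 : (0 : ℝ) < m := (Real.exp_pos _).trans_le hmlow
  have hmup : (m : ℝ) ≤ 2 * Real.exp (v' * (√n * √δ)) := by
    have h3 := (Nat.ceil_lt_add_one (Real.exp_pos (v' * (√n * √δ))).le).le
    have h4 : 1 ≤ Real.exp (v' * (√n * √δ)) := Real.one_le_exp (by positivity)
    linarith
  have hmpos : 0 < m := by exact_mod_cast hm0
  refine ⟨m, ⟨hmpos, ?_⟩, (Real.le_log_iff_exp_le hm0).2 hmlow⟩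
  obtain ⟨dec, hdec⟩ := W.exists_errorProb_iidCode_le h0 hmpos hadm.1 hs.le (u * (√n * √δ))
  refine ⟨iidCode (mixture x₀ P a) dec, iidCode_mem hadm.1 _, ?_, hdec.trans ?_⟩
  · rw [W.relEntropy_codeOutput_iidCode x₀ h0 hmpos hadm.1, EReal.coe_le_coe_iff, mul_comm]
    exact hadm.2
  · have hA : Real.exp (s * (u * (√n * √δ))) * W.negMGF x₀ (mixture x₀ P a) s ^ n ≤ ε / 2 := by
      refine le_trans ?_ h1
      have h5 : 0 ≤ W.negMGF x₀ (mixture x₀ P a) s :=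
        Finset.sum_nonneg fun x _ => mul_nonneg (hadm.1.1 x) (Finset.sum_nonneg fun y _ =>
          mul_nonneg (W.law_nonneg x y) (Real.exp_pos _).le)
      have h6 := pow_le_pow_left₀ h5 (hmgf s a hs.le hsM ha0 ha1.le) n
      refine (mul_le_mul_of_nonneg_left h6 (Real.exp_pos _).le).trans_eq ?_
      rw [← Real.exp_nat_mul, ← Real.exp_add, one_mul, ← mul_assoc (n : ℝ) a, hna, hd]
      congr 1
      ring
    have hB : m * (Real.exp (-(u * (√n * √δ))) *
        (1 + chiSq (W.output (mixture x₀ P a)) (W.law x₀)) ^ n) ≤ ε / 2 := by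
      refine le_trans ?_ h2
      have h7 : (1 + chiSq (W.output (mixture x₀ P a)) (W.law x₀)) ^ n ≤ K := by
        rw [chiSq_output_mixture]
        have h8 := chiSq_nonneg (q := W.output P) h0
        refine (pow_le_pow_left₀ (by positivity) ((add_comm _ _).trans_le
          (Real.add_one_le_exp (a ^ 2 * chiSq (W.output P) (W.law x₀)))) n).trans_eq ?_
        rw [← Real.exp_nat_mul, hK, ← mul_assoc, ha, div_pow, Real.sq_sqrt hn'.le]
        congr 2
        field_simp
      calc m * (Real.exp (-(u * (√n * √δ))) *
            (1 + chiSq (W.output (mixture x₀ P a)) (W.law x₀)) ^ n)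
          ≤ 2 * Real.exp (v' * (√n * √δ)) * (Real.exp (-(u * (√n * √δ))) * K) :=
            mul_le_mul hmup (mul_le_mul_of_nonneg_left h7 (Real.exp_pos _).le)
              (mul_nonneg (Real.exp_pos _).le (pow_nonneg
                (by linarith [chiSq_nonneg (q := W.output (mixture x₀ P a)) h0]) n))
              (by positivity)
        _ = 2 * K * Real.exp (-((u - v') * √δ * √n)) := by
            have e : -((u - v') * √δ * √n) = v' * (√n * √δ) + -(u * (√n * √δ)) := by ring
            rw [e, Real.exp_add]
            ring
    linarith

end DMC

namespace DMC

variable {X Y : Type*} [Fintype X] [Fintype Y] (W : DMC X Y) {x₀ : X}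

/-! ### The scaling constant is the supremum of the rates -/

theorem coe_le_liminfRate [DecidableEq Y] (h0 : ∀ y, 0 < W.law x₀ y) {δ : ℝ} (hδ : 0 < δ)
    {ε : ℝ} (hε : 0 < ε) {v : ℝ} (hv : v ∈ W.rateSet x₀ δ) :
    (v : EReal) ≤ W.liminfRate x₀ δ ε := by
  refine le_of_forall_lt_imp_le_of_dense fun c hc => ?_
  obtain ⟨v', hcv, hv'⟩ := EReal.lt_iff_exists_real_btwn.1 hc
  refine hcv.le.trans (le_liminf_of_le (by isBoundedDefault) ?_)
  filter_upwards [W.eventually_exists_achievable h0 hδ hε hv (EReal.coe_lt_coe_iff.1 hv'),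
    eventually_gt_atTop 0] with n hn hn0
  obtain ⟨m, hm, hle⟩ := hn
  have hn' : (0 : ℝ) < n := by exact_mod_cast hn0
  have hs : 0 < √(n * δ) := Real.sqrt_pos.2 (mul_pos hn' hδ)
  rw [EReal.le_div_iff_mul_le (by exact_mod_cast hs) (EReal.coe_ne_top _), ← EReal.coe_mul]
  exact (EReal.coe_le_coe_iff.2 hle).trans (le_sSup ⟨m, hm, rfl⟩)

theorem exists_one_lt_mul_lt {B b : ℝ} (hB : 0 ≤ B) (h : B < b) : ∃ η : ℝ, 1 < η ∧ η * B < b := by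
  rcases hB.eq_or_lt with rfl | hB
  · exact ⟨2, one_lt_two, by simpa using h⟩
  · obtain ⟨c, hc, hcb⟩ := exists_between h
    exact ⟨c / B, (one_lt_div hB).2 hc, by rwa [div_mul_cancel₀ _ hB.ne']⟩

/-- The strict gap between `B` and `b * (1 - ε)` absorbs both the factor `η` and the additive 1 of
the converse, which is of order `1 / √n` after normalization. -/
theorem liminfRate_le [DecidableEq Y] (h0 : ∀ y, 0 < W.law x₀ y) {δ : ℝ} (hδ : 0 < δ)
    {ε : ℝ} (hε : ε < 1) {B b : ℝ} (hB : ∀ v ∈ W.rateSet x₀ δ, v ≤ B) (hb : B < b * (1 - ε)) :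
    W.liminfRate x₀ δ ε ≤ b := by
  obtain ⟨η, hη, hηB⟩ := exists_one_lt_mul_lt (hB 0 (W.zero_mem_rateSet x₀ hδ)) hb
  refine (liminf_le_liminf (v := fun _ => (b : EReal)) ?_ (by isBoundedDefault)
    (by isBoundedDefault)).trans_eq (liminf_const _)
  filter_upwards [W.eventually_meanDiv_le h0 hδ hη, eventually_gt_atTop 0,
    (tendsto_const_div_sqrt (1 / √δ)).eventually_le_const (sub_pos.2 hηB)] with n hn hn0 hlast
  have hn' : (0 : ℝ) < n := by exact_mod_cast hn0
  have hsn : 0 < √(n : ℝ) := Real.sqrt_pos.2 hn'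
  have hsδ : 0 < √δ := Real.sqrt_pos.2 hδ
  have hs : 0 < √(n * δ) := Real.sqrt_pos.2 (mul_pos hn' hδ)
  rw [EReal.div_le_iff_le_mul (by exact_mod_cast hs) (EReal.coe_ne_top _), ← EReal.coe_mul]
  refine sSup_le ?_
  rintro _ ⟨m, hm, rfl⟩
  rw [EReal.coe_le_coe_iff]
  obtain ⟨P, hP, hle⟩ := hm.exists_log_le h0 hn0
  obtain ⟨v, hv, hPv⟩ := hn P hP
  have hvB := mul_le_mul_of_nonneg_left (hB v hv) (zero_le_one.trans hη.le)
  have hε' : 0 < 1 - ε := sub_pos.2 hε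
  rw [Real.sqrt_mul hn'.le]
  have e : n * W.meanDiv x₀ P = √n * √δ * (√n / √δ * W.meanDiv x₀ P) := by
    nth_rewrite 1 [← Real.mul_self_sqrt hn'.le]
    field_simp
  have h1 : √n * √δ * (1 / √δ / √n) = 1 := by field_simp
  have h2 : √n * √δ * (√n / √δ * W.meanDiv x₀ P + 1 / √δ / √n) ≤ √n * √δ * (b * (1 - ε)) :=
    mul_le_mul_of_nonneg_left (by linarith) (mul_pos hsn hsδ).le
  rw [mul_add, h1, ← e] at h2
  refine le_of_mul_le_mul_left (hle.trans (h2.trans_eq ?_)) hε'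
  ring

theorem coe_le_scalingConstant [DecidableEq Y] (h0 : ∀ y, 0 < W.law x₀ y) {δ : ℝ} (hδ : 0 < δ)
    {v : ℝ} (hv : v ∈ W.rateSet x₀ δ) : (v : EReal) ≤ W.scalingConstant x₀ δ := by
  refine ge_of_tendsto (W.tendsto_scalingConstant x₀ δ) ?_
  filter_upwards [self_mem_nhdsWithin] with ε hε
  exact W.coe_le_liminfRate h0 hδ hε hv

theorem scalingConstant_le [DecidableEq Y] (h0 : ∀ y, 0 < W.law x₀ y) {δ : ℝ} (hδ : 0 < δ)
    {B : ℝ} (hB : ∀ v ∈ W.rateSet x₀ δ, v ≤ B) : W.scalingConstant x₀ δ ≤ B := by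
  refine le_of_forall_gt_imp_ge_of_dense fun c hc => ?_
  obtain ⟨b, hb, hbc⟩ := EReal.lt_iff_exists_real_btwn.1 hc
  refine le_trans ?_ hbc.le
  have ht : Tendsto (fun ε : ℝ => b * (1 - ε)) (𝓝 0) (𝓝 (b * (1 - 0))) :=
    (tendsto_id.const_sub 1).const_mul b
  rw [sub_zero, mul_one] at ht
  refine le_of_tendsto (W.tendsto_scalingConstant x₀ δ) ?_
  filter_upwards [(ht.eventually_const_lt (EReal.coe_lt_coe_iff.1 hb)).filter_mono
      nhdsWithin_le_nhds, (eventually_lt_nhds one_pos).filter_mono nhdsWithin_le_nhds]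
    with ε hε hε1
  exact W.liminfRate_le h0 hδ hε1 hB hε

theorem tendsto_maxInfo [DecidableEq Y] (h0 : ∀ y, 0 < W.law x₀ y) {δ : ℝ} (hδ : 0 < δ) :
    Tendsto (fun n : ℕ => ((√(n / δ) * W.maxInfo x₀ (δ / n) : ℝ) : EReal)) atTop
      (𝓝 (W.scalingConstant x₀ δ)) := by
  have hsδ : 0 < √δ := Real.sqrt_pos.2 hδ
  have hmax : ∀ n : ℕ, IsGreatest (W.mutualInfo '' W.admissible x₀ (δ / n))
      (W.maxInfo x₀ (δ / n)) := fun n => W.isGreatest_maxInfo h0 (by positivity)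
  refine tendsto_order.2 ⟨fun c hc => ?_, fun c hc => ?_⟩
  -- If no rate exceeded `c`, a real number strictly between `c` and `L` would bound all rates and
  -- hence `L`. This covers `L = ⊤`, for which the upper half below is vacuous.
  · obtain ⟨v, hv, hcv⟩ : ∃ v ∈ W.rateSet x₀ δ, c < (v : EReal) := by
      obtain ⟨b, hb, hbL⟩ := EReal.lt_iff_exists_real_btwn.1 hc
      by_contra! h
      exact hbL.not_ge (W.scalingConstant_le h0 hδ fun v hv =>
        EReal.coe_le_coe_iff.1 ((h v hv).trans hb.le))
    obtain ⟨b, hb, hbv⟩ := EReal.lt_iff_exists_real_btwn.1 hcv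
    rw [EReal.coe_lt_coe_iff] at hbv
    obtain ⟨P, hP, κ, hκ0, hκ, rfl⟩ := hv
    filter_upwards [W.eventually_mixture_mem_admissible h0 hP hκ0 hκ, eventually_gt_atTop 0,
      (tendsto_const_div_sqrt √δ).eventually_le_const (sub_pos.2 hbv)] with n hn hn0 hlast
    refine hb.trans_le (EReal.coe_le_coe_iff.2 ?_)
    have hn' : (0 : ℝ) < n := by exact_mod_cast hn0
    have hsn : 0 < √(n : ℝ) := Real.sqrt_pos.2 hn'
    refine le_trans ?_ (mul_le_mul_of_nonneg_left ((hmax n).2 ⟨_, hn.2, rfl⟩)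
      (Real.sqrt_nonneg _))
    have hadm := (W.mem_admissible_iff h0).1 hn.2
    rw [W.mutualInfo_eq h0 hadm.1.1, meanDiv_mixture, Real.sqrt_div hn'.le]
    have h1 : √n / √δ * (κ / √n * W.meanDiv x₀ P) = κ * W.meanDiv x₀ P / √δ := by
      field_simp
    have h2 : √n / √δ * (δ / n) = √δ / √n := by
      rw [div_mul_div_comm, div_eq_div_iff (by positivity) hsn.ne']
      nth_rewrite 1 [← Real.mul_self_sqrt hδ.le]
      nth_rewrite 3 [← Real.mul_self_sqrt hn'.le]
      ring
    have h3 := mul_le_mul_of_nonneg_left hadm.2 (div_pos hsn hsδ).le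
    rw [mul_sub, h1]
    linarith
  · obtain ⟨b, hb, hbc⟩ := EReal.lt_iff_exists_real_btwn.1 hc
    obtain ⟨B, hLB, hBb⟩ := EReal.lt_iff_exists_real_btwn.1 hb
    rw [EReal.coe_lt_coe_iff] at hBb
    have hB : ∀ v ∈ W.rateSet x₀ δ, v ≤ B := fun v hv =>
      EReal.coe_le_coe_iff.1 ((W.coe_le_scalingConstant h0 hδ hv).trans hLB.le)
    obtain ⟨η, hη, hηB⟩ := exists_one_lt_mul_lt (hB 0 (W.zero_mem_rateSet x₀ hδ)) hBb
    filter_upwards [W.eventually_meanDiv_le h0 hδ hη] with n hn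
    refine (EReal.coe_le_coe_iff.2 ?_).trans_lt hbc
    obtain ⟨P, hP, hPmax⟩ := (hmax n).1
    obtain ⟨v, hv, hPv⟩ := hn P hP
    have hadm := (W.mem_admissible_iff h0).1 hP
    have hvB := mul_le_mul_of_nonneg_left (hB v hv) (zero_le_one.trans hη.le)
    rw [← hPmax, W.mutualInfo_eq h0 hadm.1.1, Real.sqrt_div n.cast_nonneg]
    have hD := realKL_nonneg h0 (W.output_mem hadm.1).1 (W.sum_output_eq x₀ hadm.1)
    have := mul_nonneg (div_nonneg (Real.sqrt_nonneg n) hsδ.le) hD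
    rw [mul_sub]
    linarith

/-! ### Redundant symbols -/

theorem Redundant.exists_output_eq (h : W.Redundant x₀) :
    ∃ P ∈ stdSimplex ℝ X, P x₀ = 0 ∧ W.output P = W.law x₀ := by
  refine mem_convexHull_iff.1 h {q | ∃ P ∈ stdSimplex ℝ X, P x₀ = 0 ∧ W.output P = q} ?_ ?_
  · rintro _ ⟨x, hx, rfl⟩
    exact ⟨pointMass x, pointMass_mem x, by simpa [pointMass] using hx, W.output_pointMass x⟩
  · rintro _ ⟨P, hP, hP0, rfl⟩ _ ⟨P', hP', hP0', rfl⟩ a b ha hb hab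
    refine ⟨a • P + b • P', convex_stdSimplex ℝ X hP hP' ha hb hab, by simp [hP0, hP0'], ?_⟩
    funext y
    simp [output, add_mul, mul_assoc, Finset.sum_add_distrib, Finset.mul_sum]

theorem realKL_pos {Y : Type*} [Fintype Y] {q p : Y → ℝ} (hp : ∀ y, 0 < p y)
    (hq : ∀ y, 0 ≤ q y) (h : ∑ y, q y = ∑ y, p y) (hne : q ≠ p) : 0 < realKL q p := by
  have hnn : ∀ y, 0 ≤ p y * InformationTheory.klFun (q y / p y) := fun y =>
    mul_nonneg (hp y).le (InformationTheory.klFun_nonneg (div_nonneg (hq y) (hp y).le))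
  obtain ⟨y, hy⟩ := Function.ne_iff.1 hne
  rw [realKL_eq_sum_klFun hp h]
  refine Finset.sum_pos' (fun y _ => hnn y) ⟨y, Finset.mem_univ y, (hnn y).lt_of_ne fun h0 => hy ?_⟩
  have h1 := (mul_eq_zero.1 h0.symm).resolve_left (hp y).ne'
  rw [InformationTheory.klFun_eq_zero_iff (div_nonneg (hq y) (hp y).le),
    div_eq_one_iff_eq (hp y).ne'] at h1
  exact h1

/-- A mixture of other symbols reproduces `Q₀`, so it meets the constraint for every `κ`;
injectivity makes its mean divergence positive. The `κ` chosen below realizes the rate `|r| + 1`. -/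
theorem scalingConstant_eq_top_of_redundant [DecidableEq Y] (hinj : Function.Injective W.law)
    (h0 : ∀ y, 0 < W.law x₀ y) {δ : ℝ} (hδ : 0 < δ) (h : W.Redundant x₀) :
    W.scalingConstant x₀ δ = ⊤ := by
  obtain ⟨P, hP, hP0, hout⟩ := h.exists_output_eq
  have hpos : 0 < W.meanDiv x₀ P := by
    obtain ⟨x, hx⟩ : ∃ x, P x ≠ 0 := by
      by_contra! hz
      have := hP.2
      simp [hz] at this
    refine Finset.sum_pos' (fun x _ => mul_nonneg (hP.1 x) (realKL_nonneg h0 (W.law_nonneg x)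
      (by rw [W.sum_law, W.sum_law]))) ⟨x, Finset.mem_univ x, mul_pos ((hP.1 x).lt_of_ne' hx)
      (realKL_pos h0 (W.law_nonneg x) (by rw [W.sum_law, W.sum_law]) fun e => hx ?_)⟩
    rw [hinj e, hP0]
  have hsδ : 0 < √δ := Real.sqrt_pos.2 hδ
  have hchi : chiSq (W.output P) (W.law x₀) = 0 := by simp [chiSq, hout]
  refine EReal.eq_top_iff_forall_lt _ |>.2 fun r => ?_
  refine lt_of_lt_of_le (EReal.coe_lt_coe_iff.2 (lt_add_one r |>.trans_le
    (by gcongr; exact le_abs_self r))) (W.coe_le_scalingConstant h0 hδ (v := |r| + 1)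
    ⟨P, hP, (|r| + 1) * √δ / W.meanDiv x₀ P, by positivity, ?_, ?_⟩)
  · rw [hchi, mul_zero]
    linarith
  · field_simp

end DMC

theorem corollary1 {X Y : Type*} [Fintype X] [Fintype Y] [DecidableEq Y]
    (W : DMC X Y) (x₀ : X)
    (hinj : Function.Injective W.law)
    (hsupp : ∀ y, 0 < W.law x₀ y)
    (δ : ℝ) (hδ : 0 < δ) :
    -- for every `n`, the maximum of `I(P_n, W)` is attained
    (∀ n : ℕ, 1 ≤ n →
      IsGreatest (W.mutualInfo '' W.admissible x₀ (δ / n)) (W.maxInfo x₀ (δ / n))) ∧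
    -- the limit exists and equals `L`
    Tendsto (fun n : ℕ => ((√(n / δ) * W.maxInfo x₀ (δ / n) : ℝ) : EReal)) atTop
      (𝓝 (W.scalingConstant x₀ δ)) ∧
    -- `L` is the maximum, over admissible sequences `(P_n)`, of the limit of `√(n/δ) I(P_n, W)`
    IsGreatest {l : EReal | ∃ P : ℕ → X → ℝ, (∀ n : ℕ, 1 ≤ n → P n ∈ W.admissible x₀ (δ / n)) ∧
        Tendsto (fun n : ℕ => ((√(n / δ) * W.mutualInfo (P n) : ℝ) : EReal)) atTop (𝓝 l)}
      (W.scalingConstant x₀ δ) ∧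
    -- `L` is infinite in the redundant case
    (W.Redundant x₀ → W.scalingConstant x₀ δ = ⊤) := by
  -- This includes `n = 0`, where `δ / 0 = 0` is still a valid radius, so maximizers can be chosen
  -- for all `n` at once.
  have hmax : ∀ n : ℕ, IsGreatest (W.mutualInfo '' W.admissible x₀ (δ / n))
      (W.maxInfo x₀ (δ / n)) := fun n => W.isGreatest_maxInfo hsupp (by positivity)
  have hlim := W.tendsto_maxInfo hsupp hδ
  refine ⟨fun n _ => hmax n, hlim, ⟨?_, ?_⟩,
    W.scalingConstant_eq_top_of_redundant hinj hsupp hδ⟩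
  · choose P hP hPmax using fun n => (hmax n).1
    exact ⟨P, fun n _ => hP n, by simpa only [hPmax] using hlim⟩
  · rintro l ⟨P, hP, hl⟩
    refine le_of_tendsto_of_tendsto hl hlim ?_
    filter_upwards [eventually_ge_atTop 1] with n hn
    exact EReal.coe_le_coe_iff.2
      (mul_le_mul_of_nonneg_left ((hmax n).2 ⟨_, hP n hn, rfl⟩) (Real.sqrt_nonneg _))
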